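/- **Type theories.** A dependent type theory derives statements $\mathcal J\,[\Gamma]$, where $\Gamma=[x_0\in A_0,\dots,x_{n-1}\in A_{n-1}(x_0,\dots,x_{n-2})]$ is a context and $\mathcal J$ is a judgement of one of the forms $A\in\mathrm{Type}$, $a\in A$, $A=B\in\mathrm{Type}$, $a=b\in A$. Type and term expressions are built from variables by type and term constructors, which may bind variables. The derivable statements are closed under the variable rule $x\in A\,[\Gamma,x\in A]$ (if $A \in \mathrm{Type}\,[\Gamma]$), weakening, substitution, reflexivity, symmetry and transitivity of definitional equality of types and of terms, conversion along definitional equality of types, and congruence (substituting definitionally equal terms in a type or term gives definitionally equal results); a statement is derivable only if its presuppositions are (its context is well formed, $A$ is a type if $a\in A$, and so on). Further constructors and rules are allowed. The theory has *strong unit and sum types* if it has a type $1$ and a term $*\in 1$ with $a=*\in 1$ for all $a\in 1$, and a type $\Sigma x\in A.B$ for all $A\in\mathrm{Type}$ and $B\in\mathrm{Type}\,[x\in A]$, with pairing $\mathbf p ab\in\Sigma x\in A.B$ for $a\in A$, $b\in B[a/x]$ and projections $\mathbf p_0c\in A$, $\mathbf p_1c\in B[\mathbf p_0c/x]$ for $c\in\Sigma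 x\in A.B$, such that $\mathbf p_0(\mathbf pab)=a$, $\mathbf p_1(\mathbf pab)=b$, $\mathbf p(\mathbf p_0c)(\mathbf p_1c)=c$ hold definitionally, together with the congruence rules. It has *propositional identity types* if there are a type $\mathrm{Id}_A(a,b)$ for $a,b\in A$ and a term $\mathbf r(a)\in\mathrm{Id}_A(a,a)$ for $a\in A$ such that, whenever $C(x,y,u)\in\mathrm{Type}\,[x\in A,y\in A,u\in\mathrm{Id}_A(x,y),\Delta(x,y,u)]$ and $d(x)\in C(x,x,\mathbf r(x))\,[x\in A,\Delta(x,x,\mathbf r(x))]$ for a context extension $\Delta$ (possibly empty), there are terms $$\mathbf J(a,b,p,d)\in C(a,b,p)\ [\Delta(a,b,p)]\qquad\text{for all } a,b\in A,\ p\in\mathrm{Id}_A(a,b),$$ $$\mathbf H(a,d)\in\mathrm{Id}_{C(a,a,\mathbf r(a))}\bigl(\mathbf J(a,a,\mathbf r(a),d),\,d(a)\bigr)\ [\Delta(a,a,\mathbf r(a))]\qquad\text{for all } a\in A,$$ together with the congruence rules. All these rules hold in an arbitrary ambient context, and all these constructors commute with substitution. **Classifying category.** Its objects are the well-formed contexts,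 where two contexts of the same length are identified if their types are (successively) derivably equal. A morphism from $\Delta$ to $\Gamma=[x_0\in A_0,\dots,x_{n-1}\in A_{n-1}]$ is a sequence of terms $(t_0,\dots,t_{n-1})$ with $t_i\in A_i(t_0,\dots,t_{i-1})\,[\Delta]$ derivable for all $i$, where two sequences are identified if they are componentwise derivably equal; composition is substitution. *Display maps* are the projections $[\Gamma,x\in A]\to\Gamma$; *dependent projections* are the closure of the display maps under identities and composition; *fibrations* are the morphisms isomorphic (in the arrow category) to a dependent projection. Two morphisms $f,g:X\to Y$ are *homotopic* if there are a closed type $A$, an isomorphism $e:Y\cong[x\in A]$ and a morphism $h:X\to[x\in A,y\in A,u\in\mathrm{Id}_A(x,y)]$ whose $x$- and $y$-components are $ef$ and $eg$. A morphism $f:X\to Y$ is a *homotopy equivalence* if there is $g:Y\to X$ such that $gf$ and $fg$ are homotopic to $1_X$ and $1_Y$. **Path categories.** A *path category* is a category with two classes of morphisms, fibrations and weak equivalences (a morphism in both classes is an acyclic fibration), such that: 1. isomorphisms are fibrations and fibrations are closed under composition; 2. the pullback of a fibration along any map exists and is a fibration; 3. there is a terminal object and every map to it is a fibration; 4. isomorphisms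 are weak equivalences; 5. if $f:A\to B$, $g:B\to C$, $h:C\to D$ are such that $gf$ and $hg$ are weak equivalences, then so are $f$, $g$, $h$ and $hgf$; 6. for every object $B$ the diagonal $B\to B\times B$ factors as a weak equivalence followed by a fibration; 7. every acyclic fibration has a section; 8. the pullback of an acyclic fibration along any map exists and is an acyclic fibration. **Theorem.** The classifying category of any type theory with strong unit and sum types and propositional identity types is a path category, with the fibrations described above and with the homotopy equivalences as the weak equivalences. -/

import Mathlib

open CategoryTheory CategoryTheory.Limits

universe u v

namespace DTT

/-! ### Raw syntax -/

/-- The two kinds of raw expressions: type expressions and term expressions. -/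
inductive Kind : Type
  | ty
  | tm

/-- `extend n k` is the number of variables in scope after adding `k` variables to `n` given ones;
it equals `n + k`, but is computed so that contexts and telescopes can be concatenated
without transporting along equations of natural numbers. -/
def extend : ℕ → ℕ → ℕ
  | n, 0 => n
  | n, k + 1 => extend (n + 1) k

/-- A signature of type and term constructors. The constructor `o` forms an expression of kind
`kind o` out of `arity o` arguments; the `i`-th argument is an expression of kind `argKind o i`,
in which `argBind o i` variables get bound. -/
structure Signature : Type (u + 1) where
  Op : Type u
  kind : Op → Kind
  arity : Op → ℕ
  argKind : (o : Op) → Fin (arity o) → Kind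
  argBind : (o : Op) → Fin (arity o) → ℕ

/-- Raw expressions of a given kind, with free variables among `n` given ones
(de Bruijn indices: the variable `0` is the last one of the context). -/
inductive Expr (S : Signature.{u}) : Kind → ℕ → Type u
  | var {n : ℕ} (i : Fin n) : Expr S Kind.tm n
  | op {n : ℕ} (o : S.Op)
      (args : ∀ i : Fin (S.arity o), Expr S (S.argKind o i) (extend n (S.argBind o i))) :
      Expr S (S.kind o) n

/-- Raw types in `n` variables. -/
abbrev Ty (S : Signature.{u}) (n : ℕ) : Type u := Expr S Kind.ty n

/-- Raw terms in `n` variables. -/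
abbrev Tm (S : Signature.{u}) (n : ℕ) : Type u := Expr S Kind.tm n

/-- Substitutions: a term in `m` variables for each of `n` variables. -/
abbrev Sub (S : Signature.{u}) (n m : ℕ) : Type u := Fin n → Tm S m

section Substitution

variable {S : Signature.{u}}

/-- Extend a renaming to one more variable. -/
def liftRen {n m : ℕ} (ρ : Fin n → Fin m) : Fin (n + 1) → Fin (m + 1) :=
  Fin.cases 0 (fun i => (ρ i).succ)

/-- Extend a renaming to `k` more variables. -/
def liftRenN : ∀ (k : ℕ) {n m : ℕ}, (Fin n → Fin m) → Fin (extend n k) → Fin (extend m k)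
  | 0, _, _, ρ => ρ
  | k + 1, _, _, ρ => liftRenN k (liftRen ρ)

/-- Renaming of variables. -/
def Expr.rename {κ : Kind} {n : ℕ} (e : Expr S κ n) : ∀ {m : ℕ}, (Fin n → Fin m) → Expr S κ m :=
  match e with
  | .var i => fun ρ => .var (ρ i)
  | .op o args => fun ρ => .op o (fun i => (args i).rename (liftRenN _ ρ))

/-- Extend a substitution to one more variable, which is mapped to itself. -/
def Sub.lift {n m : ℕ} (σ : Sub S n m) : Sub S (n + 1) (m + 1) :=
  Fin.cases (.var 0) (fun i => (σ i).rename Fin.succ)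

/-- Extend a substitution to `k` more variables, which are mapped to themselves. -/
def Sub.liftN : ∀ (k : ℕ) {n m : ℕ}, Sub S n m → Sub S (extend n k) (extend m k)
  | 0, _, _, σ => σ
  | k + 1, _, _, σ => Sub.liftN k (Sub.lift σ)

/-- Capture-avoiding simultaneous substitution. -/
def Expr.subst {κ : Kind} {n : ℕ} (e : Expr S κ n) : ∀ {m : ℕ}, Sub S n m → Expr S κ m :=
  match e with
  | .var i => fun σ => σ i
  | .op o args => fun σ => .op o (fun i => (args i).subst (Sub.liftN _ σ))

/-- The identity substitution. -/
def Sub.id (S : Signature.{u}) (n : ℕ) : Sub S n n := fun i => .var i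

/-- The weakening substitution: adds a dummy last variable. -/
def Sub.wk (S : Signature.{u}) (n : ℕ) : Sub S n (n + 1) := fun i => .var i.succ

/-- The substitution which maps the last variable to `a` and the others as `σ` does. -/
def Sub.cons {n m : ℕ} (σ : Sub S n m) (a : Tm S m) : Sub S (n + 1) m := Fin.cases a σ

/-- The restriction of a substitution to all but the last variable. -/
def Sub.tail {n m : ℕ} (σ : Sub S (n + 1) m) : Sub S n m := fun i => σ i.succ

/-- The substitution `[a/x]` of `a` for the last variable `x`. -/
def Sub.inst {n : ℕ} (a : Tm S n) : Sub S (n + 1) n := (Sub.id S n).cons a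

/-- First `σ`, then `τ`. -/
def Sub.comp {n m k : ℕ} (σ : Sub S n m) (τ : Sub S m k) : Sub S n k := fun i => (σ i).subst τ

end Substitution

/-- Raw contexts `[x₀ ∈ A₀, …, xₙ₋₁ ∈ Aₙ₋₁]` of length `n`. -/
inductive Ctx (S : Signature.{u}) : ℕ → Type u
  | nil : Ctx S 0
  | snoc {n : ℕ} (Γ : Ctx S n) (A : Ty S n) : Ctx S (n + 1)

/-- Raw context extensions (telescopes) of length `k` over a context of length `n`. -/
inductive Tel (S : Signature.{u}) : ℕ → ℕ → Type u
  | nil {n : ℕ} : Tel S n 0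
  | cons {n k : ℕ} (A : Ty S n) (Ξ : Tel S (n + 1) k) : Tel S n (k + 1)

/-- The concatenation `[Γ, Ξ]`. -/
def Ctx.append {S : Signature.{u}} :
    ∀ {k n : ℕ}, Ctx S n → Tel S n k → Ctx S (extend n k)
  | _, _, Γ, .nil => Γ
  | _, n, Γ, .cons A Ξ => Ctx.append (n := n + 1) (Γ.snoc A) Ξ

/-- Substitution in a telescope. -/
def Tel.subst {S : Signature.{u}} : ∀ {k n m : ℕ}, Tel S n k → Sub S n m → Tel S m k
  | _, _, _, .nil, _ => .nil
  | _, _, _, .cons A Ξ, σ => .cons (A.subst σ) (Ξ.subst σ.lift)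

/-- The four forms of judgement: `A ∈ Type`, `a ∈ A`, `A = B ∈ Type`, `a = b ∈ A`. -/
inductive Judgement (S : Signature.{u}) (n : ℕ) : Type u
  | isType (A : Ty S n)
  | hasType (a : Tm S n) (A : Ty S n)
  | eqType (A B : Ty S n)
  | eqTerm (a b : Tm S n) (A : Ty S n)

/-- Substitution in a judgement. -/
def Judgement.subst {S : Signature.{u}} {n m : ℕ} (J : Judgement S n) (σ : Sub S n m) :
    Judgement S m :=
  match J with
  | .isType A => .isType (A.subst σ)
  | .hasType a A => .hasType (a.subst σ) (A.subst σ)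
  | .eqType A B => .eqType (A.subst σ) (B.subst σ)
  | .eqTerm a b A => .eqTerm (a.subst σ) (b.subst σ) (A.subst σ)

/-! ### Type theories -/

/-- A dependent type theory over the signature `S`: a collection of derivable statements
`J [Γ]` closed under the basic rules of dependent type theory. Further rules may hold as well.
The rules `subst_congr_type` and `subst_congr_term` express the convention that every type and
term constructor comes with its congruence rules. The last group of fields says that a statement
is derivable only if its presuppositions are. -/
structure TypeTheory (S : Signature.{u}) : Type u where
  Derivable : ∀ {n : ℕ}, Ctx S n → Judgement S n → Prop
  /-- the rule for variables: `x ∈ A [Γ, x ∈ A]` -/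
  var_rule : ∀ {n : ℕ} {Γ : Ctx S n} {A : Ty S n}, Derivable Γ (.isType A) →
    Derivable (Γ.snoc A) (.hasType (.var 0) (A.subst (Sub.wk S n)))
  /-- from `J [Γ, Ξ]` and `A ∈ Type [Γ]` infer `J [Γ, x ∈ A, Ξ]` -/
  weakening : ∀ {n k : ℕ} {Γ : Ctx S n} {A : Ty S n} {Ξ : Tel S n k}
    {J : Judgement S (extend n k)},
    Derivable (Γ.append Ξ) J → Derivable Γ (.isType A) →
    Derivable ((Γ.snoc A).append (Ξ.subst (Sub.wk S n))) (J.subst ((Sub.wk S n).liftN k))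
  /-- from `J [Γ, x ∈ A, Ξ]` and `a ∈ A [Γ]` infer `J[a/x] [Γ, Ξ[a/x]]` -/
  substitution : ∀ {n k : ℕ} {Γ : Ctx S n} {A : Ty S n} {Ξ : Tel S (n + 1) k}
    {J : Judgement S (extend (n + 1) k)} {a : Tm S n},
    Derivable ((Γ.snoc A).append Ξ) J → Derivable Γ (.hasType a A) →
    Derivable (Γ.append (Ξ.subst (Sub.inst a))) (J.subst ((Sub.inst a).liftN k))
  type_refl : ∀ {n : ℕ} {Γ : Ctx S n} {A : Ty S n},
    Derivable Γ (.isType A) → Derivable Γ (.eqType A A)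
  type_symm : ∀ {n : ℕ} {Γ : Ctx S n} {A B : Ty S n},
    Derivable Γ (.eqType A B) → Derivable Γ (.eqType B A)
  type_trans : ∀ {n : ℕ} {Γ : Ctx S n} {A B C : Ty S n},
    Derivable Γ (.eqType A B) → Derivable Γ (.eqType B C) → Derivable Γ (.eqType A C)
  term_refl : ∀ {n : ℕ} {Γ : Ctx S n} {A : Ty S n} {a : Tm S n},
    Derivable Γ (.hasType a A) → Derivable Γ (.eqTerm a a A)
  term_symm : ∀ {n : ℕ} {Γ : Ctx S n} {A : Ty S n} {a b : Tm S n},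
    Derivable Γ (.eqTerm a b A) → Derivable Γ (.eqTerm b a A)
  term_trans : ∀ {n : ℕ} {Γ : Ctx S n} {A : Ty S n} {a b c : Tm S n},
    Derivable Γ (.eqTerm a b A) → Derivable Γ (.eqTerm b c A) → Derivable Γ (.eqTerm a c A)
  conv_hasType : ∀ {n : ℕ} {Γ : Ctx S n} {A B : Ty S n} {a : Tm S n},
    Derivable Γ (.hasType a A) → Derivable Γ (.eqType A B) → Derivable Γ (.hasType a B)
  conv_eqTerm : ∀ {n : ℕ} {Γ : Ctx S n} {A B : Ty S n} {a b : Tm S n},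
    Derivable Γ (.eqTerm a b A) → Derivable Γ (.eqType A B) → Derivable Γ (.eqTerm a b B)
  /-- from `B ∈ Type [Γ, x ∈ A, Ξ]` and `a = a' ∈ A [Γ]` infer
  `B[a/x] = B[a'/x] ∈ Type [Γ, Ξ[a/x]]` -/
  subst_congr_type : ∀ {n k : ℕ} {Γ : Ctx S n} {A : Ty S n} {Ξ : Tel S (n + 1) k}
    {B : Ty S (extend (n + 1) k)} {a a' : Tm S n},
    Derivable ((Γ.snoc A).append Ξ) (.isType B) → Derivable Γ (.eqTerm a a' A) →
    Derivable (Γ.append (Ξ.subst (Sub.inst a)))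
      (.eqType (B.subst ((Sub.inst a).liftN k)) (B.subst ((Sub.inst a').liftN k)))
  /-- from `b ∈ B [Γ, x ∈ A, Ξ]` and `a = a' ∈ A [Γ]` infer
  `b[a/x] = b[a'/x] ∈ B[a/x] [Γ, Ξ[a/x]]` -/
  subst_congr_term : ∀ {n k : ℕ} {Γ : Ctx S n} {A : Ty S n} {Ξ : Tel S (n + 1) k}
    {B : Ty S (extend (n + 1) k)} {b : Tm S (extend (n + 1) k)} {a a' : Tm S n},
    Derivable ((Γ.snoc A).append Ξ) (.hasType b B) → Derivable Γ (.eqTerm a a' A) →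
    Derivable (Γ.append (Ξ.subst (Sub.inst a)))
      (.eqTerm (b.subst ((Sub.inst a).liftN k)) (b.subst ((Sub.inst a').liftN k))
        (B.subst ((Sub.inst a).liftN k)))
  /-- statements are derivable only in well-formed contexts -/
  presup_ctx : ∀ {n : ℕ} {Γ : Ctx S n} {A : Ty S n} {J : Judgement S (n + 1)},
    Derivable (Γ.snoc A) J → Derivable Γ (.isType A)
  presup_hasType : ∀ {n : ℕ} {Γ : Ctx S n} {A : Ty S n} {a : Tm S n},
    Derivable Γ (.hasType a A) → Derivable Γ (.isType A)
  presup_eqType : ∀ {n : ℕ} {Γ : Ctx S n} {A B : Ty S n},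
    Derivable Γ (.eqType A B) → Derivable Γ (.isType A)
  presup_eqTerm : ∀ {n : ℕ} {Γ : Ctx S n} {A : Ty S n} {a b : Tm S n},
    Derivable Γ (.eqTerm a b A) → Derivable Γ (.hasType a A)

/-- Well-formed contexts: each type is derivably a type in the context preceding it. -/
def TypeTheory.WF {S : Signature.{u}} (T : TypeTheory S) : ∀ {n : ℕ}, Ctx S n → Prop
  | _, .nil => True
  | _, .snoc Γ A => T.WF Γ ∧ T.Derivable Γ (.isType A)

/-- Strong unit and sum types. A type or term former is an operation on raw expressions which
commutes with substitution. The operations for pairing and the projections are allowed to depend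
on the types involved. -/
structure StrongSums {S : Signature.{u}} (T : TypeTheory S) : Type u where
  unit : ∀ {n : ℕ}, Ty S n
  star : ∀ {n : ℕ}, Tm S n
  sigma : ∀ {n : ℕ}, Ty S n → Ty S (n + 1) → Ty S n
  pair : ∀ {n : ℕ}, Ty S n → Ty S (n + 1) → Tm S n → Tm S n → Tm S n
  fst : ∀ {n : ℕ}, Ty S n → Ty S (n + 1) → Tm S n → Tm S n
  snd : ∀ {n : ℕ}, Ty S n → Ty S (n + 1) → Tm S n → Tm S n
  unit_subst : ∀ {n m : ℕ} (σ : Sub S n m), (unit (n := n)).subst σ = unit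
  star_subst : ∀ {n m : ℕ} (σ : Sub S n m), (star (n := n)).subst σ = star
  sigma_subst : ∀ {n m : ℕ} (σ : Sub S n m) (A : Ty S n) (B : Ty S (n + 1)),
    (sigma A B).subst σ = sigma (A.subst σ) (B.subst σ.lift)
  pair_subst : ∀ {n m : ℕ} (σ : Sub S n m) (A : Ty S n) (B : Ty S (n + 1)) (a b : Tm S n),
    (pair A B a b).subst σ = pair (A.subst σ) (B.subst σ.lift) (a.subst σ) (b.subst σ)
  fst_subst : ∀ {n m : ℕ} (σ : Sub S n m) (A : Ty S n) (B : Ty S (n + 1)) (c : Tm S n),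
    (fst A B c).subst σ = fst (A.subst σ) (B.subst σ.lift) (c.subst σ)
  snd_subst : ∀ {n m : ℕ} (σ : Sub S n m) (A : Ty S n) (B : Ty S (n + 1)) (c : Tm S n),
    (snd A B c).subst σ = snd (A.subst σ) (B.subst σ.lift) (c.subst σ)
  unit_form : ∀ {n : ℕ} {Γ : Ctx S n}, T.WF Γ → T.Derivable Γ (.isType unit)
  star_intro : ∀ {n : ℕ} {Γ : Ctx S n}, T.WF Γ → T.Derivable Γ (.hasType star unit)
  unit_eta : ∀ {n : ℕ} {Γ : Ctx S n} {a : Tm S n},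
    T.Derivable Γ (.hasType a unit) → T.Derivable Γ (.eqTerm a star unit)
  sigma_form : ∀ {n : ℕ} {Γ : Ctx S n} {A : Ty S n} {B : Ty S (n + 1)},
    T.Derivable Γ (.isType A) → T.Derivable (Γ.snoc A) (.isType B) →
    T.Derivable Γ (.isType (sigma A B))
  pair_intro : ∀ {n : ℕ} {Γ : Ctx S n} {A : Ty S n} {B : Ty S (n + 1)} {a b : Tm S n},
    T.Derivable (Γ.snoc A) (.isType B) →
    T.Derivable Γ (.hasType a A) → T.Derivable Γ (.hasType b (B.subst (Sub.inst a))) →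
    T.Derivable Γ (.hasType (pair A B a b) (sigma A B))
  fst_elim : ∀ {n : ℕ} {Γ : Ctx S n} {A : Ty S n} {B : Ty S (n + 1)} {c : Tm S n},
    T.Derivable (Γ.snoc A) (.isType B) →
    T.Derivable Γ (.hasType c (sigma A B)) → T.Derivable Γ (.hasType (fst A B c) A)
  snd_elim : ∀ {n : ℕ} {Γ : Ctx S n} {A : Ty S n} {B : Ty S (n + 1)} {c : Tm S n},
    T.Derivable (Γ.snoc A) (.isType B) →
    T.Derivable Γ (.hasType c (sigma A B)) →
    T.Derivable Γ (.hasType (snd A B c) (B.subst (Sub.inst (fst A B c))))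
  fst_pair : ∀ {n : ℕ} {Γ : Ctx S n} {A : Ty S n} {B : Ty S (n + 1)} {a b : Tm S n},
    T.Derivable (Γ.snoc A) (.isType B) →
    T.Derivable Γ (.hasType a A) → T.Derivable Γ (.hasType b (B.subst (Sub.inst a))) →
    T.Derivable Γ (.eqTerm (fst A B (pair A B a b)) a A)
  snd_pair : ∀ {n : ℕ} {Γ : Ctx S n} {A : Ty S n} {B : Ty S (n + 1)} {a b : Tm S n},
    T.Derivable (Γ.snoc A) (.isType B) →
    T.Derivable Γ (.hasType a A) → T.Derivable Γ (.hasType b (B.subst (Sub.inst a))) →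
    T.Derivable Γ (.eqTerm (snd A B (pair A B a b)) b (B.subst (Sub.inst a)))
  pair_eta : ∀ {n : ℕ} {Γ : Ctx S n} {A : Ty S n} {B : Ty S (n + 1)} {c : Tm S n},
    T.Derivable (Γ.snoc A) (.isType B) →
    T.Derivable Γ (.hasType c (sigma A B)) →
    T.Derivable Γ (.eqTerm (pair A B (fst A B c) (snd A B c)) c (sigma A B))
  sigma_congr : ∀ {n : ℕ} {Γ : Ctx S n} {A A' : Ty S n} {B B' : Ty S (n + 1)},
    T.Derivable Γ (.eqType A A') → T.Derivable (Γ.snoc A) (.eqType B B') →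
    T.Derivable Γ (.eqType (sigma A B) (sigma A' B'))
  pair_congr : ∀ {n : ℕ} {Γ : Ctx S n} {A : Ty S n} {B : Ty S (n + 1)} {a a' b b' : Tm S n},
    T.Derivable (Γ.snoc A) (.isType B) →
    T.Derivable Γ (.eqTerm a a' A) → T.Derivable Γ (.eqTerm b b' (B.subst (Sub.inst a))) →
    T.Derivable Γ (.eqTerm (pair A B a b) (pair A B a' b') (sigma A B))
  fst_congr : ∀ {n : ℕ} {Γ : Ctx S n} {A : Ty S n} {B : Ty S (n + 1)} {c c' : Tm S n},
    T.Derivable (Γ.snoc A) (.isType B) →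
    T.Derivable Γ (.eqTerm c c' (sigma A B)) →
    T.Derivable Γ (.eqTerm (fst A B c) (fst A B c') A)
  snd_congr : ∀ {n : ℕ} {Γ : Ctx S n} {A : Ty S n} {B : Ty S (n + 1)} {c c' : Tm S n},
    T.Derivable (Γ.snoc A) (.isType B) →
    T.Derivable Γ (.eqTerm c c' (sigma A B)) →
    T.Derivable Γ (.eqTerm (snd A B c) (snd A B c') (B.subst (Sub.inst (fst A B c))))

section IdSyntax

variable {S : Signature.{u}} (Id : ∀ {n : ℕ}, Ty S n → Tm S n → Tm S n → Ty S n)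
  (r : ∀ {n : ℕ}, Ty S n → Tm S n → Tm S n)

/-- The context extension `[x ∈ A, y ∈ A, u ∈ Id_A(x, y)]` of `Γ`. -/
def idCtx {n : ℕ} (Γ : Ctx S n) (A : Ty S n) : Ctx S (n + 3) :=
  ((Γ.snoc A).snoc (A.subst (Sub.wk S n))).snoc
    (Id ((A.subst (Sub.wk S n)).subst (Sub.wk S (n + 1))) (.var 1) (.var 0))

/-- The substitution `(a, b, p)` for the variables `x, y, u`. -/
def idInst {n : ℕ} (a b p : Tm S n) : Sub S (n + 3) n :=
  (((Sub.id S n).cons a).cons b).cons p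

/-- The substitution `(x, x, r(x))` for the variables `x, y, u`, where `x ∈ A`. -/
def idDiag {n : ℕ} (A : Ty S n) : Sub S (n + 3) (n + 1) :=
  (((Sub.wk S n).cons (.var 0)).cons (.var 0)).cons (r (A.subst (Sub.wk S n)) (.var 0))

end IdSyntax

/-- Propositional identity types: the computation rule holds only up to a term `H` of an
identity type, and the elimination and computation rules have a parameter context `Ξ`.
The operations are allowed to depend on the types involved. The substitution `σ.liftN k` leaves
the `k` variables of `Ξ` unchanged. -/
structure PropositionalIdTypes {S : Signature.{u}} (T : TypeTheory S) : Type u where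
  Id : ∀ {n : ℕ}, Ty S n → Tm S n → Tm S n → Ty S n
  r : ∀ {n : ℕ}, Ty S n → Tm S n → Tm S n
  /-- `J A Ξ C a b p d` is the term `J(a, b, p, d)` -/
  J : ∀ {n k : ℕ}, Ty S n → Tel S (n + 3) k → Ty S (extend (n + 3) k) →
    Tm S n → Tm S n → Tm S n → Tm S (extend (n + 1) k) → Tm S (extend n k)
  /-- `H A Ξ C a d` is the term `H(a, d)` -/
  H : ∀ {n k : ℕ}, Ty S n → Tel S (n + 3) k → Ty S (extend (n + 3) k) →
    Tm S n → Tm S (extend (n + 1) k) → Tm S (extend n k)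
  Id_subst : ∀ {n m : ℕ} (σ : Sub S n m) (A : Ty S n) (a b : Tm S n),
    (Id A a b).subst σ = Id (A.subst σ) (a.subst σ) (b.subst σ)
  r_subst : ∀ {n m : ℕ} (σ : Sub S n m) (A : Ty S n) (a : Tm S n),
    (r A a).subst σ = r (A.subst σ) (a.subst σ)
  J_subst : ∀ {n m k : ℕ} (σ : Sub S n m) (A : Ty S n) (Ξ : Tel S (n + 3) k)
    (C : Ty S (extend (n + 3) k)) (a b p : Tm S n) (d : Tm S (extend (n + 1) k)),
    (J A Ξ C a b p d).subst (σ.liftN k) =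
      J (A.subst σ) (Ξ.subst σ.lift.lift.lift) (C.subst (Sub.liftN k (n := n + 3) σ.lift.lift.lift))
        (a.subst σ) (b.subst σ) (p.subst σ) (d.subst (Sub.liftN k σ.lift))
  H_subst : ∀ {n m k : ℕ} (σ : Sub S n m) (A : Ty S n) (Ξ : Tel S (n + 3) k)
    (C : Ty S (extend (n + 3) k)) (a : Tm S n) (d : Tm S (extend (n + 1) k)),
    (H A Ξ C a d).subst (σ.liftN k) =
      H (A.subst σ) (Ξ.subst σ.lift.lift.lift) (C.subst (Sub.liftN k (n := n + 3) σ.lift.lift.lift))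
        (a.subst σ) (d.subst (Sub.liftN k σ.lift))
  Id_form : ∀ {n : ℕ} {Γ : Ctx S n} {A : Ty S n} {a b : Tm S n},
    T.Derivable Γ (.hasType a A) → T.Derivable Γ (.hasType b A) →
    T.Derivable Γ (.isType (Id A a b))
  r_intro : ∀ {n : ℕ} {Γ : Ctx S n} {A : Ty S n} {a : Tm S n},
    T.Derivable Γ (.hasType a A) → T.Derivable Γ (.hasType (r A a) (Id A a a))
  J_elim : ∀ {n k : ℕ} {Γ : Ctx S n} {A : Ty S n} {Ξ : Tel S (n + 3) k}
    {C : Ty S (extend (n + 3) k)} {a b p : Tm S n} {d : Tm S (extend (n + 1) k)},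
    T.Derivable ((idCtx Id Γ A).append Ξ) (.isType C) →
    T.Derivable Γ (.hasType a A) → T.Derivable Γ (.hasType b A) →
    T.Derivable Γ (.hasType p (Id A a b)) →
    T.Derivable ((Γ.snoc A).append (Ξ.subst (idDiag r A)))
      (.hasType d (C.subst ((idDiag r A).liftN k))) →
    T.Derivable (Γ.append (Ξ.subst (idInst a b p)))
      (.hasType (J A Ξ C a b p d) (C.subst ((idInst a b p).liftN k)))
  H_comp : ∀ {n k : ℕ} {Γ : Ctx S n} {A : Ty S n} {Ξ : Tel S (n + 3) k}
    {C : Ty S (extend (n + 3) k)} {a : Tm S n} {d : Tm S (extend (n + 1) k)},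
    T.Derivable ((idCtx Id Γ A).append Ξ) (.isType C) →
    T.Derivable Γ (.hasType a A) →
    T.Derivable ((Γ.snoc A).append (Ξ.subst (idDiag r A)))
      (.hasType d (C.subst ((idDiag r A).liftN k))) →
    T.Derivable (Γ.append (Ξ.subst (idInst a a (r A a))))
      (.hasType (H A Ξ C a d)
        (Id (C.subst ((idInst a a (r A a)).liftN k))
          (J A Ξ C a a (r A a) d) (d.subst ((Sub.inst a).liftN k))))
  Id_congr : ∀ {n : ℕ} {Γ : Ctx S n} {A A' : Ty S n} {a a' b b' : Tm S n},
    T.Derivable Γ (.eqType A A') → T.Derivable Γ (.eqTerm a a' A) →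
    T.Derivable Γ (.eqTerm b b' A) → T.Derivable Γ (.eqType (Id A a b) (Id A' a' b'))
  r_congr : ∀ {n : ℕ} {Γ : Ctx S n} {A : Ty S n} {a a' : Tm S n},
    T.Derivable Γ (.eqTerm a a' A) → T.Derivable Γ (.eqTerm (r A a) (r A a') (Id A a a))
  J_congr : ∀ {n k : ℕ} {Γ : Ctx S n} {A : Ty S n} {Ξ : Tel S (n + 3) k}
    {C : Ty S (extend (n + 3) k)} {a a' b b' p p' : Tm S n} {d d' : Tm S (extend (n + 1) k)},
    T.Derivable ((idCtx Id Γ A).append Ξ) (.isType C) →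
    T.Derivable Γ (.eqTerm a a' A) → T.Derivable Γ (.eqTerm b b' A) →
    T.Derivable Γ (.eqTerm p p' (Id A a b)) →
    T.Derivable ((Γ.snoc A).append (Ξ.subst (idDiag r A)))
      (.eqTerm d d' (C.subst ((idDiag r A).liftN k))) →
    T.Derivable (Γ.append (Ξ.subst (idInst a b p)))
      (.eqTerm (J A Ξ C a b p d) (J A Ξ C a' b' p' d') (C.subst ((idInst a b p).liftN k)))
  H_congr : ∀ {n k : ℕ} {Γ : Ctx S n} {A : Ty S n} {Ξ : Tel S (n + 3) k}
    {C : Ty S (extend (n + 3) k)} {a a' : Tm S n} {d d' : Tm S (extend (n + 1) k)},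
    T.Derivable ((idCtx Id Γ A).append Ξ) (.isType C) →
    T.Derivable Γ (.eqTerm a a' A) →
    T.Derivable ((Γ.snoc A).append (Ξ.subst (idDiag r A)))
      (.eqTerm d d' (C.subst ((idDiag r A).liftN k))) →
    T.Derivable (Γ.append (Ξ.subst (idInst a a (r A a))))
      (.eqTerm (H A Ξ C a d) (H A Ξ C a' d')
        (Id (C.subst ((idInst a a (r A a)).liftN k))
          (J A Ξ C a a (r A a) d) (d.subst ((Sub.inst a).liftN k))))

/-! ### Substitution lemmas -/

section SubstitutionLemmas

variable {S : Signature.{u}}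

theorem liftRenN_comp : ∀ (k : ℕ) {n m l : ℕ} (ρ : Fin n → Fin m) (θ : Fin m → Fin l),
    (liftRenN k θ) ∘ (liftRenN k ρ) = liftRenN k (θ ∘ ρ)
  | 0, _, _, _, _, _ => rfl
  | k + 1, _, _, _, ρ, θ => by
    have h : liftRen θ ∘ liftRen ρ = liftRen (θ ∘ ρ) := by
      funext i; refine Fin.cases rfl (fun _ => rfl) i
    have := liftRenN_comp k (liftRen ρ) (liftRen θ)
    rw [h] at this
    exact this

theorem Expr.rename_rename {κ : Kind} {n : ℕ} (e : Expr S κ n) :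
    ∀ {m l : ℕ} (ρ : Fin n → Fin m) (θ : Fin m → Fin l),
      (e.rename ρ).rename θ = e.rename (θ ∘ ρ) := by
  induction e with
  | var i => intros; rfl
  | op o args ih =>
    intro m l ρ θ
    simp only [Expr.rename, ih, liftRenN_comp]

theorem Sub.liftN_comp_ren : ∀ (k : ℕ) {n m l : ℕ} (ρ : Fin n → Fin m) (σ : Sub S m l),
    (fun i => Sub.liftN k σ (liftRenN k ρ i)) = Sub.liftN k (fun i => σ (ρ i))
  | 0, _, _, _, _, _ => rfl
  | k + 1, _, _, _, ρ, σ => by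
    have h : (fun i => σ.lift (liftRen ρ i)) = Sub.lift (fun i => σ (ρ i)) := by
      funext i; refine Fin.cases rfl (fun _ => rfl) i
    have := Sub.liftN_comp_ren k (liftRen ρ) σ.lift
    rw [h] at this
    exact this

theorem Expr.subst_rename {κ : Kind} {n : ℕ} (e : Expr S κ n) :
    ∀ {m l : ℕ} (ρ : Fin n → Fin m) (σ : Sub S m l),
      (e.rename ρ).subst σ = e.subst (fun i => σ (ρ i)) := by
  induction e with
  | var i => intros; rfl
  | op o args ih =>
    intro m l ρ σ
    simp only [Expr.rename, Expr.subst, ih, Sub.liftN_comp_ren]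

theorem Sub.ren_comp_liftN : ∀ (k : ℕ) {n m l : ℕ} (σ : Sub S n m) (ρ : Fin m → Fin l),
    (fun i => (Sub.liftN k σ i).rename (liftRenN k ρ)) = Sub.liftN k (fun i => (σ i).rename ρ)
  | 0, _, _, _, _, _ => rfl
  | k + 1, _, _, _, σ, ρ => by
    have h : (fun i => (σ.lift i).rename (liftRen ρ)) = Sub.lift (fun i => (σ i).rename ρ) := by
      funext i
      refine Fin.cases rfl (fun j => ?_) i
      change ((σ j).rename Fin.succ).rename (liftRen ρ) = ((σ j).rename ρ).rename Fin.succ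
      rw [Expr.rename_rename, Expr.rename_rename]
      rfl
    have := Sub.ren_comp_liftN k σ.lift (liftRen ρ)
    rw [h] at this
    exact this

theorem Expr.rename_subst {κ : Kind} {n : ℕ} (e : Expr S κ n) :
    ∀ {m l : ℕ} (σ : Sub S n m) (ρ : Fin m → Fin l),
      (e.subst σ).rename ρ = e.subst (fun i => (σ i).rename ρ) := by
  induction e with
  | var i => intros; rfl
  | op o args ih =>
    intro m l σ ρ
    simp only [Expr.rename, Expr.subst, ih, Sub.ren_comp_liftN]

theorem Sub.lift_comp {n m l : ℕ} (σ : Sub S n m) (τ : Sub S m l) :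
    σ.lift.comp τ.lift = (σ.comp τ).lift := by
  funext i
  refine Fin.cases rfl (fun j => ?_) i
  change ((σ j).rename Fin.succ).subst τ.lift = ((σ j).subst τ).rename Fin.succ
  rw [Expr.subst_rename, Expr.rename_subst]
  rfl

theorem Sub.liftN_comp : ∀ (k : ℕ) {n m l : ℕ} (σ : Sub S n m) (τ : Sub S m l),
    (Sub.liftN k σ).comp (Sub.liftN k τ) = Sub.liftN k (σ.comp τ)
  | 0, _, _, _, _, _ => rfl
  | k + 1, _, _, _, σ, τ => by
    have := Sub.liftN_comp k σ.lift τ.lift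
    rw [Sub.lift_comp] at this
    exact this

theorem Expr.subst_subst {κ : Kind} {n : ℕ} (e : Expr S κ n) :
    ∀ {m l : ℕ} (σ : Sub S n m) (τ : Sub S m l),
      (e.subst σ).subst τ = e.subst (σ.comp τ) := by
  induction e with
  | var i => intros; rfl
  | op o args ih =>
    intro m l σ τ
    simp only [Expr.subst, ih, Sub.liftN_comp]

theorem Sub.lift_id (n : ℕ) : (Sub.id S n).lift = Sub.id S (n + 1) := by
  funext i; refine Fin.cases rfl (fun _ => rfl) i

theorem Sub.liftN_id : ∀ (k n : ℕ), Sub.liftN k (Sub.id S n) = Sub.id S (extend n k)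
  | 0, _ => rfl
  | k + 1, n => by
    have := Sub.liftN_id k (n + 1)
    rw [← Sub.lift_id] at this
    exact this

theorem Expr.subst_id {κ : Kind} {n : ℕ} (e : Expr S κ n) : e.subst (Sub.id S n) = e := by
  induction e with
  | var i => rfl
  | op o args ih => simp only [Expr.subst, Sub.liftN_id, ih]

theorem Sub.liftN_ren : ∀ (k : ℕ) {n m : ℕ} (ρ : Fin n → Fin m),
    Sub.liftN k (fun i => (.var (ρ i) : Tm S m)) = fun i => .var (liftRenN k ρ i)
  | 0, _, _, _ => rfl
  | k + 1, _, _, ρ => by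
    have h : Sub.lift (fun i => (.var (ρ i) : Tm S _)) = fun i => .var (liftRen ρ i) := by
      funext i; refine Fin.cases rfl (fun _ => rfl) i
    have := Sub.liftN_ren k (liftRen ρ)
    rw [← h] at this
    exact this

theorem Expr.rename_eq_subst {κ : Kind} {n : ℕ} (e : Expr S κ n) :
    ∀ {m : ℕ} (ρ : Fin n → Fin m), e.rename ρ = e.subst (fun i => .var (ρ i)) := by
  induction e with
  | var i => intros; rfl
  | op o args ih =>
    intro m ρ
    simp only [Expr.rename, Expr.subst, ih, Sub.liftN_ren]

theorem Sub.id_comp {n m : ℕ} (σ : Sub S n m) : (Sub.id S n).comp σ = σ := rfl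

theorem Sub.comp_id {n m : ℕ} (σ : Sub S n m) : σ.comp (Sub.id S m) = σ :=
  funext fun i => (σ i).subst_id

theorem Sub.comp_assoc {n m l q : ℕ} (σ : Sub S n m) (τ : Sub S m l) (υ : Sub S l q) :
    (σ.comp τ).comp υ = σ.comp (τ.comp υ) :=
  funext fun i => (σ i).subst_subst τ υ

theorem Sub.lift_succ {n m : ℕ} (σ : Sub S n m) (i : Fin n) :
    σ.lift i.succ = (σ i).subst (Sub.wk S m) :=
  (σ i).rename_eq_subst Fin.succ

theorem Sub.tail_lift {n m : ℕ} (σ : Sub S n m) : σ.lift.tail = σ.comp (Sub.wk S m) :=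
  funext fun i => σ.lift_succ i

theorem Sub.lift_comp_cons {n m l : ℕ} (σ : Sub S n m) (τ : Sub S m l) (a : Tm S l) :
    σ.lift.comp (τ.cons a) = (σ.comp τ).cons a := by
  funext i
  refine Fin.cases rfl (fun j => ?_) i
  change ((σ j).rename Fin.succ).subst (τ.cons a) = (σ j).subst τ
  rw [Expr.subst_rename]
  rfl

theorem Sub.lift_comp_inst {n m : ℕ} (σ : Sub S n m) (a : Tm S m) :
    σ.lift.comp (Sub.inst a) = σ.cons a := by
  unfold Sub.inst
  rw [Sub.lift_comp_cons, Sub.comp_id]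

theorem Sub.cons_tail {n m : ℕ} (σ : Sub S (n + 1) m) : σ.tail.cons (σ 0) = σ := by
  funext i; refine Fin.cases rfl (fun _ => rfl) i

theorem Tel.subst_subst {k n : ℕ} (Ξ : Tel S n k) :
    ∀ {m l : ℕ} (σ : Sub S n m) (τ : Sub S m l),
      (Ξ.subst σ).subst τ = Ξ.subst (σ.comp τ) := by
  induction Ξ with
  | nil => intros; rfl
  | cons A Ξ ih =>
    intro m l σ τ
    simp only [Tel.subst, ih, Expr.subst_subst, Sub.lift_comp]

theorem Tel.subst_id {k n : ℕ} (Ξ : Tel S n k) : Ξ.subst (Sub.id S n) = Ξ := by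
  induction Ξ with
  | nil => rfl
  | cons A Ξ ih => simp only [Tel.subst, Sub.lift_id, ih, Expr.subst_id]

theorem Judgement.subst_subst {n m l : ℕ} (J : Judgement S n) (σ : Sub S n m) (τ : Sub S m l) :
    (J.subst σ).subst τ = J.subst (σ.comp τ) := by
  cases J <;> simp only [Judgement.subst, Expr.subst_subst]

theorem Judgement.subst_id {n : ℕ} (J : Judgement S n) : J.subst (Sub.id S n) = J := by
  cases J <;> simp only [Judgement.subst, Expr.subst_id]

end SubstitutionLemmas

/-! ### Context morphisms -/

namespace TypeTheory

variable {S : Signature.{u}} (T : TypeTheory S)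

/-- `T.IsMor Δ Γ t`: the terms `t` form a context morphism `Δ → Γ`, that is
`t₀ ∈ A₀, t₁ ∈ A₁(t₀), …` are derivable in context `Δ`. -/
def IsMor {m : ℕ} (Δ : Ctx S m) : ∀ {n : ℕ}, Ctx S n → Sub S n m → Prop
  | _, .nil, _ => True
  | _, .snoc Γ A, t => IsMor Δ Γ t.tail ∧ T.Derivable Δ (.hasType (t 0) (A.subst t.tail))

/-- `T.MorEq Δ Γ s t`: the equations `s₀ = t₀ ∈ A₀, s₁ = t₁ ∈ A₁(s₀), …` are derivable in
context `Δ`. -/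
def MorEq {m : ℕ} (Δ : Ctx S m) : ∀ {n : ℕ}, Ctx S n → Sub S n m → Sub S n m → Prop
  | _, .nil, _, _ => True
  | _, .snoc Γ A, s, t =>
    MorEq Δ Γ s.tail t.tail ∧ T.Derivable Δ (.eqTerm (s 0) (t 0) (A.subst s.tail))

/-- `T.CtxEq Γ Γ'`: two contexts of the same length are identified if
`A₀ = B₀ ∈ Type [], A₁ = B₁ ∈ Type [x₀ ∈ A₀], …` are derivable. -/
def CtxEq : ∀ {n : ℕ}, Ctx S n → Ctx S n → Prop
  | _, .nil, .nil => True
  | _, .snoc Γ A, .snoc Γ' A' => CtxEq Γ Γ' ∧ T.Derivable Γ (.eqType A A')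

variable {T}

theorem weaken {n : ℕ} {Γ : Ctx S n} {A : Ty S n} {J : Judgement S n}
    (h : T.Derivable Γ J) (hA : T.Derivable Γ (.isType A)) :
    T.Derivable (Γ.snoc A) (J.subst (Sub.wk S n)) :=
  T.weakening (n := n) (k := 0) (Γ := Γ) (Ξ := .nil) (J := J) h hA

theorem subst_inst {n : ℕ} {Γ : Ctx S n} {A : Ty S n} {J : Judgement S (n + 1)} {a : Tm S n}
    (h : T.Derivable (Γ.snoc A) J) (ha : T.Derivable Γ (.hasType a A)) :
    T.Derivable Γ (J.subst (Sub.inst a)) :=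
  T.substitution (n := n) (k := 0) (Γ := Γ) (A := A) (Ξ := .nil) (J := J) h ha

theorem subst_aux_nil {m k : ℕ} {Δ : Ctx S m} (hΔ : T.WF Δ) {Ξ : Tel S 0 k}
    {J : Judgement S (extend 0 k)} (h : T.Derivable (Ctx.nil.append Ξ) J) (t : Sub S 0 m) :
    T.Derivable (Δ.append (Ξ.subst t)) (J.subst (t.liftN k)) := by
  induction Δ with
  | nil =>
    have ht : t = Sub.id S 0 := funext fun i => i.elim0
    subst ht
    rw [Tel.subst_id, Sub.liftN_id, Judgement.subst_id]
    exact h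
  | @snoc m Δ A ih =>
    have h1 := T.weakening (ih hΔ.1 (fun i => i.elim0)) hΔ.2
    rw [Tel.subst_subst, Judgement.subst_subst, Sub.liftN_comp] at h1
    have ht : t = Sub.comp (fun i => i.elim0) (Sub.wk S m) := funext fun i => i.elim0
    rw [ht]
    exact h1

theorem subst_aux {m : ℕ} {Δ : Ctx S m} (hΔ : T.WF Δ) {n : ℕ} {Γ : Ctx S n} :
    ∀ {k : ℕ} {Ξ : Tel S n k} {J : Judgement S (extend n k)} {t : Sub S n m},
      T.IsMor Δ Γ t → T.Derivable (Γ.append Ξ) J →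
      T.Derivable (Δ.append (Ξ.subst t)) (J.subst (t.liftN k)) := by
  induction Γ with
  | nil => intro k Ξ J t _ h; exact subst_aux_nil hΔ h t
  | @snoc n Γ A ih =>
    intro k Ξ J t ht h
    have h1 : T.Derivable ((Δ.snoc (A.subst t.tail)).append (Ξ.subst t.tail.lift))
        (J.subst (t.tail.lift.liftN k)) := ih (k := k + 1) (Ξ := .cons A Ξ) ht.1 h
    have h2 := T.substitution h1 ht.2
    rw [Tel.subst_subst, Judgement.subst_subst, Sub.liftN_comp, Sub.lift_comp_inst,
      Sub.cons_tail] at h2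
    exact h2

/-- Derivable statements are stable under substitution along context morphisms. -/
theorem subst_mor {m n : ℕ} {Δ : Ctx S m} {Γ : Ctx S n} (hΔ : T.WF Δ) {J : Judgement S n}
    {t : Sub S n m} (ht : T.IsMor Δ Γ t) (h : T.Derivable Γ J) : T.Derivable Δ (J.subst t) :=
  subst_aux (k := 0) (Ξ := .nil) hΔ ht h

theorem IsMor.comp {l m n : ℕ} {Θ : Ctx S l} {Δ : Ctx S m} {Γ : Ctx S n} (hΘ : T.WF Θ)
    {t : Sub S n m} {s : Sub S m l} (ht : T.IsMor Δ Γ t) (hs : T.IsMor Θ Δ s) :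
    T.IsMor Θ Γ (t.comp s) := by
  induction Γ with
  | nil => trivial
  | snoc Γ A ih =>
    refine ⟨ih ht.1, ?_⟩
    have := subst_mor hΘ hs ht.2
    simp only [Judgement.subst, Expr.subst_subst] at this
    exact this

theorem IsMor.wk {m n : ℕ} {Δ : Ctx S m} {Γ : Ctx S n} {A : Ty S m}
    (hA : T.Derivable Δ (.isType A)) {t : Sub S n m} (ht : T.IsMor Δ Γ t) :
    T.IsMor (Δ.snoc A) Γ (t.comp (Sub.wk S m)) := by
  induction Γ with
  | nil => trivial
  | snoc Γ B ih =>
    refine ⟨ih ht.1, ?_⟩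
    have := weaken ht.2 hA
    simp only [Judgement.subst, Expr.subst_subst] at this
    exact this

theorem isMor_of_ctxEq : ∀ {n : ℕ} {Γ Γ' : Ctx S n}, T.WF Γ' → T.CtxEq Γ Γ' →
    T.IsMor Γ' Γ (Sub.id S n)
  | _, .nil, .nil, _, _ => trivial
  | _, .snoc Γ A, .snoc Γ' A', hw, h => by
    have ih := isMor_of_ctxEq hw.1 h.1
    refine ⟨IsMor.wk hw.2 ih, ?_⟩
    have e := subst_mor hw.1 ih h.2
    rw [Judgement.subst_id] at e
    exact T.conv_hasType (T.var_rule hw.2) (T.type_symm (weaken e hw.2))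

theorem ctx_conv {n : ℕ} {Γ Γ' : Ctx S n} (hw : T.WF Γ') (h : T.CtxEq Γ Γ')
    {J : Judgement S n} (hJ : T.Derivable Γ J) : T.Derivable Γ' J := by
  have := subst_mor hw (isMor_of_ctxEq hw h) hJ
  rwa [Judgement.subst_id] at this

theorem CtxEq.refl : ∀ {n : ℕ} {Γ : Ctx S n}, T.WF Γ → T.CtxEq Γ Γ
  | _, .nil, _ => trivial
  | _, .snoc _ _, h => ⟨CtxEq.refl h.1, T.type_refl h.2⟩

theorem CtxEq.symm : ∀ {n : ℕ} {Γ Γ' : Ctx S n}, T.WF Γ' → T.CtxEq Γ Γ' → T.CtxEq Γ' Γ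
  | _, .nil, .nil, _, _ => trivial
  | _, .snoc _ _, .snoc _ _, hw, h =>
    ⟨CtxEq.symm hw.1 h.1, ctx_conv hw.1 h.1 (T.type_symm h.2)⟩

theorem CtxEq.trans : ∀ {n : ℕ} {Γ Γ' Γ'' : Ctx S n}, T.WF Γ → T.WF Γ' →
    T.CtxEq Γ Γ' → T.CtxEq Γ' Γ'' → T.CtxEq Γ Γ''
  | _, .nil, .nil, .nil, _, _, _, _ => trivial
  | _, .snoc _ _, .snoc _ _, .snoc _ _, hw, hw', h, h' =>
    ⟨CtxEq.trans hw.1 hw'.1 h.1 h'.1,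
      T.type_trans h.2 (ctx_conv hw.1 (CtxEq.symm hw'.1 h.1) h'.2)⟩

theorem wf_of_derivable : ∀ {n : ℕ} {Γ : Ctx S n} {J : Judgement S n},
    T.Derivable Γ J → T.WF Γ
  | _, .nil, _, _ => trivial
  | _, .snoc _ _, _, h => ⟨wf_of_derivable (T.presup_ctx h), T.presup_ctx h⟩

theorem wf_of_append : ∀ {k n : ℕ} {Γ : Ctx S n} {Ξ : Tel S n k},
    T.WF (Γ.append Ξ) → T.WF Γ
  | _, _, _, .nil, h => h
  | _, _, _, .cons _ Ξ, h => (wf_of_append (Ξ := Ξ) h).1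

theorem CtxEq.append : ∀ {k n : ℕ} {Γ Γ' : Ctx S n} {Ξ : Tel S n k},
    T.WF (Γ.append Ξ) → T.CtxEq Γ Γ' → T.CtxEq (Γ.append Ξ) (Γ'.append Ξ)
  | _, _, _, _, .nil, _, h => h
  | _, _, _, _, .cons _ Ξ, hw, h =>
    CtxEq.append (Ξ := Ξ) hw ⟨h, T.type_refl (wf_of_append (Ξ := Ξ) hw).2⟩

variable (T) in
/-- Substituting `s` and `t` in types over extensions of `Γ` gives equal types. -/
def CongrTy {n m : ℕ} (Γ : Ctx S n) (Δ : Ctx S m) (s t : Sub S n m) : Prop :=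
  ∀ ⦃k : ℕ⦄ ⦃Ξ : Tel S n k⦄ ⦃B : Ty S (extend n k)⦄, T.Derivable (Γ.append Ξ) (.isType B) →
    T.Derivable (Δ.append (Ξ.subst s)) (.eqType (B.subst (s.liftN k)) (B.subst (t.liftN k)))

variable (T) in
/-- Substituting `s` and `t` in terms over extensions of `Γ` gives equal terms. -/
def CongrTm {n m : ℕ} (Γ : Ctx S n) (Δ : Ctx S m) (s t : Sub S n m) : Prop :=
  ∀ ⦃k : ℕ⦄ ⦃Ξ : Tel S n k⦄ ⦃b : Tm S (extend n k)⦄ ⦃B : Ty S (extend n k)⦄,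
    T.Derivable (Γ.append Ξ) (.hasType b B) →
    T.Derivable (Δ.append (Ξ.subst s))
      (.eqTerm (b.subst (s.liftN k)) (b.subst (t.liftN k)) (B.subst (s.liftN k)))

theorem CongrTy.ctxEq : ∀ {k n m : ℕ} {Γ : Ctx S n} {Δ Δ' : Ctx S m} {s t : Sub S n m}
    {Ξ : Tel S n k}, T.CongrTy Γ Δ s t → T.WF (Γ.append Ξ) → T.CtxEq Δ Δ' →
    T.CtxEq (Δ.append (Ξ.subst s)) (Δ'.append (Ξ.subst t))
  | _, _, _, _, _, _, _, _, .nil, _, _, h => h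
  | _, n, m, Γ, Δ, Δ', s, t, .cons A Ξ, hc, hw, h => by
    have hA : T.Derivable Δ (.eqType (A.subst s) (A.subst t)) :=
      hc (k := 0) (Ξ := .nil) (wf_of_append (n := n + 1) (Γ := Γ.snoc A) (Ξ := Ξ) hw).2
    have hc' : T.CongrTy (Γ.snoc A) (Δ.snoc (A.subst s)) s.lift t.lift :=
      fun k Θ B hB => hc (k := k + 1) (Ξ := .cons A Θ) hB
    exact CongrTy.ctxEq (n := n + 1) (Γ := Γ.snoc A) (Δ := Δ.snoc (A.subst s))
      (Δ' := Δ'.snoc (A.subst t)) (Ξ := Ξ) hc' hw ⟨h, hA⟩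

theorem congrTy_inst {m : ℕ} {Δ : Ctx S m} {A : Ty S m} {a b : Tm S m}
    (h : T.Derivable Δ (.eqTerm a b A)) : T.CongrTy (Δ.snoc A) Δ (Sub.inst a) (Sub.inst b) :=
  fun _ _ _ hB => T.subst_congr_type hB h

theorem MorEq.congr {m n : ℕ} {Δ : Ctx S m} (hΔ : T.WF Δ) {Γ : Ctx S n} :
    ∀ {s t : Sub S n m}, T.IsMor Δ Γ s → T.MorEq Δ Γ s t →
      T.CongrTy Γ Δ s t ∧ T.CongrTm Γ Δ s t := by
  induction Γ with
  | nil =>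
    intro s t hs _
    have hst : s = t := funext fun i => i.elim0
    subst hst
    exact ⟨fun k Ξ B hB => T.type_refl (subst_aux hΔ hs hB),
      fun k Ξ b B hb => T.term_refl (subst_aux hΔ hs hb)⟩
  | @snoc n Γ A ih =>
    intro s t hs h
    obtain ⟨ih1, ih2⟩ := ih hs.1 h.1
    have hb0 : T.Derivable Δ (.hasType (t 0) (A.subst s.tail)) :=
      T.presup_eqTerm (T.term_symm h.2)
    -- substitution into the extension of `Δ` by `A`
    have key : ∀ {k : ℕ} {Ξ : Tel S (n + 1) k} {J : Judgement S (extend (n + 1) k)},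
        T.Derivable ((Γ.snoc A).append Ξ) J →
        T.Derivable ((Δ.snoc (A.subst s.tail)).append (Ξ.subst s.tail.lift))
          (J.subst (s.tail.lift.liftN k)) := fun {k Ξ J} hJ =>
      subst_aux (k := k + 1) (Ξ := .cons A Ξ) hΔ hs.1 hJ
    have conv : ∀ {k : ℕ} {Ξ : Tel S (n + 1) k} {J : Judgement S (extend (n + 1) k)}
        {K : Judgement S (extend m k)},
        T.Derivable ((Γ.snoc A).append Ξ) J →
        T.Derivable (Δ.append (Ξ.subst (s.tail.cons (t 0)))) K →
        T.Derivable (Δ.append (Ξ.subst s)) K := by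
      intro k Ξ J K hJ hK
      have hw := wf_of_derivable (key hJ)
      have e := CongrTy.ctxEq (congrTy_inst (T.term_symm h.2)) hw (CtxEq.refl hΔ)
      have hw' := wf_of_derivable (T.substitution (key hJ) hs.2)
      rw [Tel.subst_subst, Tel.subst_subst, Sub.lift_comp_inst, Sub.lift_comp_inst,
        Sub.cons_tail] at e
      rw [Tel.subst_subst, Sub.lift_comp_inst, Sub.cons_tail] at hw'
      exact ctx_conv hw' e hK
    have ty1 : ∀ {k : ℕ} {Ξ : Tel S (n + 1) k} {B : Ty S (extend (n + 1) k)},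
        T.Derivable ((Γ.snoc A).append Ξ) (.isType B) →
        T.Derivable (Δ.append (Ξ.subst s))
          (.eqType (B.subst (s.liftN k)) (B.subst ((s.tail.cons (t 0)).liftN k))) := by
      intro k Ξ B hB
      have e := T.subst_congr_type (key hB) h.2
      rw [Tel.subst_subst, Expr.subst_subst, Expr.subst_subst, Sub.liftN_comp, Sub.liftN_comp,
        Sub.lift_comp_inst, Sub.lift_comp_inst, Sub.cons_tail] at e
      exact e
    refine ⟨fun k Ξ B hB => T.type_trans (ty1 hB) (conv hB ?_),
      fun k Ξ b B hb => ?_⟩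
    · have e : T.Derivable ((Δ.snoc (A.subst s.tail)).append (Ξ.subst s.tail.lift))
          (.eqType (B.subst (s.tail.lift.liftN k)) (B.subst (t.tail.lift.liftN k))) :=
        ih1 (k := k + 1) (Ξ := .cons A Ξ) hB
      have e' := T.substitution e hb0
      simp only [Judgement.subst] at e'
      rw [Tel.subst_subst, Expr.subst_subst, Expr.subst_subst, Sub.liftN_comp, Sub.liftN_comp,
        Sub.lift_comp_inst, Sub.lift_comp_inst, Sub.cons_tail] at e'
      exact e'
    · have hB := T.presup_hasType hb
      have e1 := T.subst_congr_term (key hb) h.2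
      rw [Tel.subst_subst, Expr.subst_subst, Expr.subst_subst, Expr.subst_subst, Sub.liftN_comp,
        Sub.liftN_comp, Sub.lift_comp_inst, Sub.lift_comp_inst, Sub.cons_tail] at e1
      have e : T.Derivable ((Δ.snoc (A.subst s.tail)).append (Ξ.subst s.tail.lift))
          (.eqTerm (b.subst (s.tail.lift.liftN k)) (b.subst (t.tail.lift.liftN k))
            (B.subst (s.tail.lift.liftN k))) :=
        ih2 (k := k + 1) (Ξ := .cons A Ξ) hb
      have e' := T.substitution e hb0
      simp only [Judgement.subst] at e'
      rw [Tel.subst_subst, Expr.subst_subst, Expr.subst_subst, Expr.subst_subst, Sub.liftN_comp,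
        Sub.liftN_comp, Sub.lift_comp_inst, Sub.lift_comp_inst, Sub.cons_tail] at e'
      exact T.term_trans e1
        (T.conv_eqTerm (conv hb e') (T.type_symm (ty1 hB)))

theorem MorEq.subst_type {m n : ℕ} {Δ : Ctx S m} {Γ : Ctx S n} (hΔ : T.WF Δ) {s t : Sub S n m}
    (hs : T.IsMor Δ Γ s) (h : T.MorEq Δ Γ s t) {B : Ty S n} (hB : T.Derivable Γ (.isType B)) :
    T.Derivable Δ (.eqType (B.subst s) (B.subst t)) :=
  (MorEq.congr hΔ hs h).1 (k := 0) (Ξ := .nil) hB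

theorem MorEq.subst_term {m n : ℕ} {Δ : Ctx S m} {Γ : Ctx S n} (hΔ : T.WF Δ) {s t : Sub S n m}
    (hs : T.IsMor Δ Γ s) (h : T.MorEq Δ Γ s t) {b : Tm S n} {B : Ty S n}
    (hb : T.Derivable Γ (.hasType b B)) :
    T.Derivable Δ (.eqTerm (b.subst s) (b.subst t) (B.subst s)) :=
  (MorEq.congr hΔ hs h).2 (k := 0) (Ξ := .nil) hb

theorem MorEq.refl {m n : ℕ} {Δ : Ctx S m} {Γ : Ctx S n} {s : Sub S n m}
    (hs : T.IsMor Δ Γ s) : T.MorEq Δ Γ s s := by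
  induction Γ with
  | nil => trivial
  | snoc Γ A ih => exact ⟨ih hs.1, T.term_refl hs.2⟩

theorem MorEq.symm {m n : ℕ} {Δ : Ctx S m} {Γ : Ctx S n} (hΔ : T.WF Δ) (hΓ : T.WF Γ)
    {s t : Sub S n m} (hs : T.IsMor Δ Γ s) (h : T.MorEq Δ Γ s t) : T.MorEq Δ Γ t s := by
  induction Γ with
  | nil => trivial
  | snoc Γ A ih =>
    exact ⟨ih hΓ.1 hs.1 h.1,
      T.conv_eqTerm (T.term_symm h.2) (MorEq.subst_type hΔ hs.1 h.1 hΓ.2)⟩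

theorem MorEq.trans {m n : ℕ} {Δ : Ctx S m} {Γ : Ctx S n} (hΔ : T.WF Δ) (hΓ : T.WF Γ)
    {s t w : Sub S n m} (hs : T.IsMor Δ Γ s) (h : T.MorEq Δ Γ s t) (h' : T.MorEq Δ Γ t w) :
    T.MorEq Δ Γ s w := by
  induction Γ with
  | nil => trivial
  | snoc Γ A ih =>
    exact ⟨ih hΓ.1 hs.1 h.1 h'.1, T.term_trans h.2
      (T.conv_eqTerm h'.2 (T.type_symm (MorEq.subst_type hΔ hs.1 h.1 hΓ.2)))⟩

theorem MorEq.comp_left {l m n : ℕ} {Θ : Ctx S l} {Δ : Ctx S m} {Γ : Ctx S n} (hΘ : T.WF Θ)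
    {t t' : Sub S n m} {s : Sub S m l} (hs : T.IsMor Θ Δ s) (h : T.MorEq Δ Γ t t') :
    T.MorEq Θ Γ (t.comp s) (t'.comp s) := by
  induction Γ with
  | nil => trivial
  | snoc Γ A ih =>
    refine ⟨ih h.1, ?_⟩
    have := subst_mor hΘ hs h.2
    simp only [Judgement.subst, Expr.subst_subst] at this
    exact this

theorem MorEq.comp_right {l m n : ℕ} {Θ : Ctx S l} {Δ : Ctx S m} {Γ : Ctx S n} (hΘ : T.WF Θ)
    {t : Sub S n m} {s s' : Sub S m l} (ht : T.IsMor Δ Γ t) (hs : T.IsMor Θ Δ s)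
    (h : T.MorEq Θ Δ s s') : T.MorEq Θ Γ (t.comp s) (t.comp s') := by
  induction Γ with
  | nil => trivial
  | snoc Γ A ih =>
    refine ⟨ih ht.1, ?_⟩
    have := MorEq.subst_term hΘ hs h ht.2
    rw [Expr.subst_subst] at this
    exact this

theorem IsMor.congr_ctx {m n : ℕ} {Δ Δ' : Ctx S m} {Γ Γ' : Ctx S n} (hΔ' : T.WF Δ')
    (hΓ : T.WF Γ) (hΓ' : T.WF Γ') (h : T.CtxEq Δ Δ') (h' : T.CtxEq Γ Γ') {t : Sub S n m}
    (ht : T.IsMor Δ Γ t) : T.IsMor Δ' Γ' t := by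
  have h1 : T.IsMor Δ' Γ t := by
    have := IsMor.comp hΔ' ht (isMor_of_ctxEq hΔ' h)
    rwa [Sub.comp_id] at this
  have := IsMor.comp hΔ' (isMor_of_ctxEq hΓ (CtxEq.symm hΓ' h')) h1
  rwa [Sub.id_comp] at this

theorem MorEq.congr_ctx {m n : ℕ} {Δ Δ' : Ctx S m} {Γ Γ' : Ctx S n} (hΔ' : T.WF Δ')
    (hΓ : T.WF Γ) (hΓ' : T.WF Γ') (h : T.CtxEq Δ Δ') (h' : T.CtxEq Γ Γ') {s t : Sub S n m}
    (hs : T.IsMor Δ Γ s) (hst : T.MorEq Δ Γ s t) : T.MorEq Δ' Γ' s t := by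
  have h1 : T.MorEq Δ' Γ s t := by
    have := MorEq.comp_left hΔ' (isMor_of_ctxEq hΔ' h) hst
    rwa [Sub.comp_id, Sub.comp_id] at this
  have h2 : T.IsMor Δ' Γ s := IsMor.congr_ctx hΔ' hΓ hΓ h (CtxEq.refl hΓ) hs
  have := MorEq.comp_right hΔ' (isMor_of_ctxEq hΓ (CtxEq.symm hΓ' h')) h2 h1
  rwa [Sub.id_comp, Sub.id_comp] at this

theorem isMor_id {n : ℕ} {Γ : Ctx S n} (hΓ : T.WF Γ) : T.IsMor Γ Γ (Sub.id S n) :=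
  isMor_of_ctxEq hΓ (CtxEq.refl hΓ)

theorem isMor_wk {n : ℕ} {Γ : Ctx S n} {A : Ty S n} (h : T.WF (Γ.snoc A)) :
    T.IsMor (Γ.snoc A) Γ (Sub.wk S n) :=
  (isMor_id h).1

/-! ### The classifying category -/

variable (T)

/-- Well-formed contexts of length `n`. -/
def WFCtx (n : ℕ) : Type u := {Γ : Ctx S n // T.WF Γ}

/-- Identification of contexts of the same length. -/
instance ctxSetoid (n : ℕ) : Setoid (T.WFCtx n) where
  r Γ Γ' := T.CtxEq Γ.1 Γ'.1
  iseqv :=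
    { refl := fun Γ => CtxEq.refl Γ.2
      symm := fun {_ Γ'} h => CtxEq.symm Γ'.2 h
      trans := fun {Γ Γ' _} h h' => CtxEq.trans Γ.2 Γ'.2 h h' }

/-- The objects of the classifying category: equivalence classes of contexts. -/
def ClassifyingCategory : Type u := Σ n : ℕ, Quotient (T.ctxSetoid n)

namespace ClassifyingCategory

variable {T}

/-- The object given by a context. -/
def mk {n : ℕ} (Γ : Ctx S n) (hΓ : T.WF Γ) : T.ClassifyingCategory :=
  ⟨n, Quotient.mk (T.ctxSetoid n) ⟨Γ, hΓ⟩⟩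

/-- The sequences of terms which represent a morphism from `X` to `Y`. -/
def IsHom (X Y : T.ClassifyingCategory) (t : Sub S Y.1 X.1) : Prop :=
  Quotient.lift₂ (fun (Δ : T.WFCtx X.1) (Γ : T.WFCtx Y.1) => T.IsMor Δ.1 Γ.1 t)
    (fun Δ Γ Δ' Γ' h h' => propext
      ⟨IsMor.congr_ctx Δ'.2 Γ.2 Γ'.2 h h',
        IsMor.congr_ctx Δ.2 Γ'.2 Γ.2 (CtxEq.symm Δ'.2 h) (CtxEq.symm Γ'.2 h')⟩) X.2 Y.2

/-- The sequences of terms which represent a morphism from `X` to `Y`, as a type. -/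
def PreHom (X Y : T.ClassifyingCategory) : Type u := {t : Sub S Y.1 X.1 // IsHom X Y t}

/-- Identification of sequences of terms representing a morphism from `X` to `Y`. -/
def HomEq (X Y : T.ClassifyingCategory) (s t : PreHom X Y) : Prop :=
  ∃ (Δ : T.WFCtx X.1) (Γ : T.WFCtx Y.1), Quotient.mk _ Δ = X.2 ∧ Quotient.mk _ Γ = Y.2 ∧
    T.MorEq Δ.1 Γ.1 s.1 t.1

theorem homEq_mk {m n : ℕ} {Δ : T.WFCtx m} {Γ : T.WFCtx n}
    {s t : PreHom (T := T) ⟨m, Quotient.mk _ Δ⟩ ⟨n, Quotient.mk _ Γ⟩} :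
    HomEq _ _ s t ↔ T.MorEq Δ.1 Γ.1 s.1 t.1 := by
  constructor
  · rintro ⟨Δ', Γ', h, h', e⟩
    have h1 : T.CtxEq Δ'.1 Δ.1 := Quotient.exact h
    have h2 : T.CtxEq Γ'.1 Γ.1 := Quotient.exact h'
    have hs : T.IsMor Δ.1 Γ.1 s.1 := s.2
    exact MorEq.congr_ctx Δ.2 Γ'.2 Γ.2 h1 h2
      (IsMor.congr_ctx Δ'.2 Γ.2 Γ'.2 (CtxEq.symm Δ.2 h1) (CtxEq.symm Γ.2 h2) hs) e
  · intro e
    exact ⟨Δ, Γ, rfl, rfl, e⟩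

instance homSetoid (X Y : T.ClassifyingCategory) : Setoid (PreHom X Y) where
  r := HomEq X Y
  iseqv := by
    obtain ⟨m, X⟩ := X
    obtain ⟨n, Y⟩ := Y
    induction X using Quotient.ind with | _ Δ => ?_
    induction Y using Quotient.ind with | _ Γ => ?_
    exact
      { refl := fun s => homEq_mk.2 (MorEq.refl s.2)
        symm := fun {s t} h => homEq_mk.2 (MorEq.symm Δ.2 Γ.2 s.2 (homEq_mk.1 h))
        trans := fun {s t w} h h' =>
          homEq_mk.2 (MorEq.trans Δ.2 Γ.2 s.2 (homEq_mk.1 h) (homEq_mk.1 h')) }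

/-- Morphisms of the classifying category: equivalence classes of sequences of terms. -/
def Hom (X Y : T.ClassifyingCategory) : Type u := Quotient (homSetoid X Y)

/-- The identity morphism is represented by the sequence of variables. -/
def preId (X : T.ClassifyingCategory) : PreHom X X :=
  ⟨Sub.id S X.1, by
    obtain ⟨m, X⟩ := X
    induction X using Quotient.ind with | _ Γ => exact isMor_id Γ.2⟩

/-- Composition is given by substitution. -/
def preComp {X Y Z : T.ClassifyingCategory} (s : PreHom X Y) (t : PreHom Y Z) : PreHom X Z :=
  ⟨t.1.comp s.1, by
    obtain ⟨l, X⟩ := X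
    obtain ⟨m, Y⟩ := Y
    obtain ⟨n, Z⟩ := Z
    induction X using Quotient.ind with | _ Θ => ?_
    induction Y using Quotient.ind with | _ Δ => ?_
    induction Z using Quotient.ind with | _ Γ => ?_
    exact IsMor.comp Θ.2 (Δ := Δ.1) t.2 s.2⟩

theorem preComp_congr {X Y Z : T.ClassifyingCategory} {s s' : PreHom X Y} {t t' : PreHom Y Z}
    (hs : HomEq X Y s s') (ht : HomEq Y Z t t') : HomEq X Z (preComp s t) (preComp s' t') := by
  obtain ⟨l, X⟩ := X
  obtain ⟨m, Y⟩ := Y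
  obtain ⟨n, Z⟩ := Z
  induction X using Quotient.ind with | _ Θ => ?_
  induction Y using Quotient.ind with | _ Δ => ?_
  induction Z using Quotient.ind with | _ Γ => ?_
  rw [homEq_mk] at hs ht ⊢
  have h1 : T.IsMor Θ.1 Δ.1 s.1 := s.2
  have h1' : T.IsMor Θ.1 Δ.1 s'.1 := s'.2
  have h2 : T.IsMor Δ.1 Γ.1 t.1 := t.2
  exact MorEq.trans Θ.2 Γ.2 (IsMor.comp Θ.2 h2 h1) (MorEq.comp_right Θ.2 h2 h1 hs)
    (MorEq.comp_left Θ.2 h1' ht)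

/-- The classifying category of the type theory `T`. -/
instance category : Category.{u} T.ClassifyingCategory where
  Hom := Hom
  id X := Quotient.mk _ (preId X)
  comp {X Y Z} := Quotient.map₂ preComp (fun _ _ hs _ _ ht => preComp_congr hs ht)
  id_comp {X Y} f := by
    induction f using Quotient.ind with | _ t => ?_
    exact congrArg (Quotient.mk _) (Subtype.ext (Sub.comp_id t.1))
  comp_id {X Y} f := by
    induction f using Quotient.ind with | _ t => ?_
    exact congrArg (Quotient.mk _) (Subtype.ext (Sub.id_comp t.1))
  assoc {W X Y Z} f g h := by
    induction f using Quotient.ind with | _ s => ?_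
    induction g using Quotient.ind with | _ t => ?_
    induction h using Quotient.ind with | _ w => ?_
    exact congrArg (Quotient.mk _) (Subtype.ext (Sub.comp_assoc w.1 t.1 s.1).symm)

/-- The morphism given by a sequence of terms. -/
def homMk {m n : ℕ} {Δ : Ctx S m} {Γ : Ctx S n} (hΔ : T.WF Δ) (hΓ : T.WF Γ) (t : Sub S n m)
    (ht : T.IsMor Δ Γ t) : mk Δ hΔ ⟶ mk Γ hΓ :=
  Quotient.mk (homSetoid (mk Δ hΔ) (mk Γ hΓ)) ⟨t, ht⟩

/-- The map `[Γ, x ∈ A] → Γ` dropping the last type. -/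
def proj {n : ℕ} (Γ : Ctx S n) (A : Ty S n) (h : T.WF (Γ.snoc A)) :
    mk (Γ.snoc A) h ⟶ mk Γ h.1 :=
  homMk h h.1 (Sub.wk S n) (isMor_wk h)

end ClassifyingCategory

open ClassifyingCategory

/-- The display maps. -/
inductive displayMaps : MorphismProperty T.ClassifyingCategory
  | proj {n : ℕ} (Γ : Ctx S n) (A : Ty S n) (h : T.WF (Γ.snoc A)) :
      displayMaps (ClassifyingCategory.proj Γ A h)

/-- The dependent projections: the closure of the display maps under identities and composition. -/
def dependentProjections : MorphismProperty T.ClassifyingCategory :=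
  T.displayMaps.multiplicativeClosure

/-- The fibrations: the morphisms isomorphic to dependent projections. -/
def fibrations : MorphismProperty T.ClassifyingCategory :=
  T.dependentProjections.isoClosure

end TypeTheory

namespace PropositionalIdTypes

open TypeTheory TypeTheory.ClassifyingCategory

variable {S : Signature.{u}} {T : TypeTheory S} (I : PropositionalIdTypes T)

theorem wf_nil_snoc {A : Ty S 0} (hA : T.Derivable .nil (.isType A)) :
    T.WF (Ctx.nil.snoc A) := ⟨trivial, hA⟩

theorem wf_idCtx {n : ℕ} {Γ : Ctx S n} {A : Ty S n} (hA : T.Derivable Γ (.isType A)) :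
    T.WF (idCtx I.Id Γ A) := by
  have h1 := weaken hA hA
  exact ⟨⟨⟨wf_of_derivable hA, hA⟩, h1⟩, I.Id_form (weaken (T.var_rule hA) h1) (T.var_rule h1)⟩

theorem isMor_src {A : Ty S 0} (hA : T.Derivable .nil (.isType A)) :
    T.IsMor (idCtx I.Id .nil A) (Ctx.nil.snoc A) (fun _ => .var 2) := by
  have h1 := weaken hA hA
  have h : T.Derivable (idCtx I.Id .nil A) (.hasType (.var 2)
      (((A.subst (Sub.wk S 0)).subst (Sub.wk S 1)).subst (Sub.wk S 2))) :=
    weaken (weaken (T.var_rule hA) h1) (I.wf_idCtx hA).2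
  rw [Expr.subst_subst, Expr.subst_subst] at h
  refine ⟨trivial, ?_⟩
  have e : Sub.tail (fun _ => .var 2) = (Sub.wk S 0).comp ((Sub.wk S 1).comp (Sub.wk S 2)) :=
    funext fun i => i.elim0
  rw [e]
  exact h

theorem isMor_tgt {A : Ty S 0} (hA : T.Derivable .nil (.isType A)) :
    T.IsMor (idCtx I.Id .nil A) (Ctx.nil.snoc A) (fun _ => .var 1) := by
  have h1 := weaken hA hA
  have h : T.Derivable (idCtx I.Id .nil A) (.hasType (.var 1)
      (((A.subst (Sub.wk S 0)).subst (Sub.wk S 1)).subst (Sub.wk S 2))) :=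
    weaken (T.var_rule h1) (I.wf_idCtx hA).2
  rw [Expr.subst_subst, Expr.subst_subst] at h
  refine ⟨trivial, ?_⟩
  have e : Sub.tail (fun _ => .var 1) = (Sub.wk S 0).comp ((Sub.wk S 1).comp (Sub.wk S 2)) :=
    funext fun i => i.elim0
  rw [e]
  exact h

/-- The object `[x ∈ A]` for a closed type `A`. -/
def typeObj {A : Ty S 0} (hA : T.Derivable .nil (.isType A)) : T.ClassifyingCategory :=
  ClassifyingCategory.mk (Ctx.nil.snoc A) (wf_nil_snoc hA)

/-- The object `[x ∈ A, y ∈ A, u ∈ Id_A(x, y)]` for a closed type `A`. -/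
def pathObj {A : Ty S 0} (hA : T.Derivable .nil (.isType A)) : T.ClassifyingCategory :=
  ClassifyingCategory.mk (idCtx I.Id .nil A) (I.wf_idCtx hA)

/-- The map `(x, y, u) ↦ x`. -/
def src {A : Ty S 0} (hA : T.Derivable .nil (.isType A)) : I.pathObj hA ⟶ typeObj hA :=
  homMk (I.wf_idCtx hA) (wf_nil_snoc hA) (fun _ => .var 2) (I.isMor_src hA)

/-- The map `(x, y, u) ↦ y`. -/
def tgt {A : Ty S 0} (hA : T.Derivable .nil (.isType A)) : I.pathObj hA ⟶ typeObj hA :=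
  homMk (I.wf_idCtx hA) (wf_nil_snoc hA) (fun _ => .var 1) (I.isMor_tgt hA)

/-- Two parallel maps `f, g : X → Y` are homotopic if, after identifying `Y` with a closed type
`A` by means of an isomorphism, they are propositionally equal as elements of type `A`. -/
def Homotopic {X Y : T.ClassifyingCategory} (f g : X ⟶ Y) : Prop :=
  ∃ (A : Ty S 0) (hA : T.Derivable .nil (.isType A)) (e : Y ≅ typeObj hA)
    (h : X ⟶ I.pathObj hA), h ≫ I.src hA = f ≫ e.hom ∧ h ≫ I.tgt hA = g ≫ e.hom

/-- The homotopy equivalences. -/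
def homotopyEquivalences : MorphismProperty T.ClassifyingCategory :=
  fun X Y f => ∃ g : Y ⟶ X, I.Homotopic (f ≫ g) (𝟙 X) ∧ I.Homotopic (g ≫ f) (𝟙 Y)

end PropositionalIdTypes

/-! ### Path categories -/

/-- A path object on `B`, relative to classes of weak equivalences and fibrations: a factorisation
of the diagonal `B → B × B` as a weak equivalence followed by a fibration. -/
structure PathObject {C : Type u} [Category.{v} C] (weq fib : MorphismProperty C) (B : C) where
  prod : BinaryFan B B
  isLimit : IsLimit prod
  obj : C
  r : B ⟶ obj
  st : obj ⟶ prod.pt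
  weq_r : weq r
  fib_st : fib st
  fac_fst : r ≫ st ≫ prod.fst = 𝟙 B
  fac_snd : r ≫ st ≫ prod.snd = 𝟙 B

/-- The structure of a path category on a category `C`. -/
structure PathCategory (C : Type u) [Category.{v} C] where
  fib : MorphismProperty C
  weq : MorphismProperty C
  fib_of_isIso : ∀ {X Y : C} (f : X ⟶ Y), IsIso f → fib f
  fib_comp : ∀ {X Y Z : C} (f : X ⟶ Y) (g : Y ⟶ Z), fib f → fib g → fib (f ≫ g)
  hasPullback : ∀ {X Y Z : C} (p : X ⟶ Z) (f : Y ⟶ Z), fib p → HasPullback p f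
  fib_pullback : ∀ {W X Y Z : C} {g : W ⟶ X} {q : W ⟶ Y} {p : X ⟶ Z} {f : Y ⟶ Z},
    IsPullback g q p f → fib p → fib q
  hasTerminal : HasTerminal C
  fib_terminal : ∀ {X Z : C} (f : X ⟶ Z), IsTerminal Z → fib f
  weq_of_isIso : ∀ {X Y : C} (f : X ⟶ Y), IsIso f → weq f
  two_out_of_six : ∀ {A B C' D : C} (f : A ⟶ B) (g : B ⟶ C') (h : C' ⟶ D),
    weq (f ≫ g) → weq (g ≫ h) → weq f ∧ weq g ∧ weq h ∧ weq (f ≫ g ≫ h)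
  pathObject : ∀ B : C, Nonempty (PathObject weq fib B)
  acyclic_section : ∀ {X Y : C} (p : X ⟶ Y), fib p → weq p → ∃ s : Y ⟶ X, s ≫ p = 𝟙 Y
  acyclic_pullback : ∀ {W X Y Z : C} {g : W ⟶ X} {q : W ⟶ Y} {p : X ⟶ Z} {f : Y ⟶ Z},
    IsPullback g q p f → fib p → weq p → fib q ∧ weq q

end DTT

/-!
Strong unit and sum types make every context isomorphic to a closed type, and every composite of
display maps isomorphic to a single display map. Hence a fibration is, up to isomorphism, a display
map, and its pullbacks are computed by substitution.

Path induction yields transport along identity proofs, so homotopy is a congruence on the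
classifying category. The homotopy equivalences are exactly the maps inverted by the quotient by
this congruence, which gives two-out-of-six. Moreover, the display map of a type `A` is a homotopy
equivalence if and only if `A` is contractible, that is, `A` has an element to which every element
is propositionally equal; this condition provides a section and is stable under substitution.
Finally, `[x ∈ A, y ∈ A, u ∈ Id_A(x, y)]` is a path object for `[x ∈ A]`: path induction shows that
maps out of it which are homotopic on reflexivity proofs are homotopic.
-/

namespace DTT

/-! ### Computing with substitutions -/

section SubstitutionCalculus

variable {S : Signature.{u}}

attribute [simp] Expr.subst_subst Expr.subst_id Sub.comp_assoc Sub.id_comp Sub.comp_id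
  Sub.lift_comp Sub.lift_comp_cons Sub.lift_comp_inst Sub.tail_lift Sub.cons_tail

instance {m : ℕ} : Subsingleton (Sub S 0 m) := ⟨fun _ _ => funext fun i => i.elim0⟩

@[simp]
theorem Sub.cons_zero {n m : ℕ} (σ : Sub S n m) (a : Tm S m) : σ.cons a 0 = a := rfl

@[simp]
theorem Expr.var_subst {n m : ℕ} (i : Fin n) (σ : Sub S n m) :
    (Expr.var i : Tm S n).subst σ = σ i := rfl

@[simp]
theorem Sub.tail_cons {n m : ℕ} (σ : Sub S n m) (a : Tm S m) : (σ.cons a).tail = σ := rfl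

@[simp]
theorem Sub.tail_inst {n : ℕ} (a : Tm S n) : (Sub.inst a).tail = Sub.id S n := rfl

@[simp]
theorem Sub.inst_zero {n : ℕ} (a : Tm S n) : Sub.inst a 0 = a := rfl

@[simp]
theorem Sub.wk_comp {n m : ℕ} (σ : Sub S (n + 1) m) : (Sub.wk S n).comp σ = σ.tail := rfl

@[simp]
theorem Sub.tail_comp {n m l : ℕ} (σ : Sub S (n + 1) m) (τ : Sub S m l) :
    σ.tail.comp τ = (σ.comp τ).tail := rfl

@[simp]
theorem Sub.cons_comp {n m l : ℕ} (σ : Sub S n m) (a : Tm S m) (τ : Sub S m l) :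
    (σ.cons a).comp τ = (σ.comp τ).cons (a.subst τ) := by
  funext i
  exact Fin.cases rfl (fun _ => rfl) i

@[simp]
theorem Sub.inst_comp {n m : ℕ} (a : Tm S n) (τ : Sub S n m) :
    (Sub.inst a).comp τ = τ.cons (a.subst τ) :=
  Sub.cons_comp _ _ _

@[simp]
theorem Sub.tail_lift_comp {n m l : ℕ} (σ : Sub S n m) (τ : Sub S (m + 1) l) :
    (σ.lift.comp τ).tail = σ.comp τ.tail := by
  rw [← Sub.tail_comp, Sub.tail_lift, Sub.comp_assoc, Sub.wk_comp]

theorem Expr.subst_wk_subst_lift {κ : Kind} {n m : ℕ} (e : Expr S κ n) (σ : Sub S n m) :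
    (e.subst (Sub.wk S n)).subst σ.lift = (e.subst σ).subst (Sub.wk S m) := by
  rw [Expr.subst_subst, Expr.subst_subst, Sub.wk_comp, Sub.tail_lift]

theorem Expr.subst_wk_subst_inst {κ : Kind} {n : ℕ} (e : Expr S κ n) (a : Tm S n) :
    (e.subst (Sub.wk S n)).subst (Sub.inst a) = e := by
  rw [Expr.subst_subst, Sub.wk_comp, Sub.tail_inst, Expr.subst_id]

theorem Sub.cons_eq_const {m : ℕ} (σ : Sub S 0 m) (a : Tm S m) : σ.cons a = fun _ => a :=
  funext (Fin.cases rfl fun i => i.elim0)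

/-- A closed expression, regarded as an expression in `m` variables. -/
def Expr.ofClosed {κ : Kind} (e : Expr S κ 0) (m : ℕ) : Expr S κ m := e.subst fun i => i.elim0

@[simp]
theorem Expr.subst_eq_ofClosed {κ : Kind} {m : ℕ} (e : Expr S κ 0) (σ : Sub S 0 m) :
    e.subst σ = e.ofClosed m :=
  congrArg (fun τ : Sub S 0 m => e.subst τ) (Subsingleton.elim _ _)

@[simp]
theorem Expr.ofClosed_subst {κ : Kind} {n m : ℕ} (e : Expr S κ 0) (σ : Sub S n m) :
    (e.ofClosed n).subst σ = e.ofClosed m := by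
  rw [Expr.ofClosed, Expr.subst_subst, Expr.subst_eq_ofClosed]

end SubstitutionCalculus

namespace TypeTheory

variable {S : Signature.{u}} {T : TypeTheory S}

theorem isMor_inst {n : ℕ} {Γ : Ctx S n} {A : Ty S n} {a : Tm S n}
    (ha : T.Derivable Γ (.hasType a A)) : T.IsMor Γ (Γ.snoc A) (Sub.inst a) :=
  ⟨isMor_id (wf_of_derivable ha), by simpa using ha⟩

theorem wf_snoc_subst {m n : ℕ} {Δ : Ctx S m} {Γ : Ctx S n} {A : Ty S n} (hΔ : T.WF Δ)
    (h : T.WF (Γ.snoc A)) {t : Sub S n m} (ht : T.IsMor Δ Γ t) : T.WF (Δ.snoc (A.subst t)) :=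
  ⟨hΔ, subst_mor hΔ ht h.2⟩

theorem IsMor.cons {m n : ℕ} {Δ : Ctx S m} {Γ : Ctx S n} {A : Ty S n} {s : Sub S n m} {a : Tm S m}
    (hs : T.IsMor Δ Γ s) (ha : T.Derivable Δ (.hasType a (A.subst s))) :
    T.IsMor Δ (Γ.snoc A) (s.cons a) :=
  ⟨hs, ha⟩

theorem IsMor.lift {m n : ℕ} {Δ : Ctx S m} {Γ : Ctx S n} (hΔ : T.WF Δ) {t : Sub S n m}
    (ht : T.IsMor Δ Γ t) {A : Ty S n} (hA : T.Derivable Γ (.isType A)) :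
    T.IsMor (Δ.snoc (A.subst t)) (Γ.snoc A) t.lift := by
  have hAt : T.Derivable Δ (.isType (A.subst t)) := subst_mor hΔ ht hA
  refine ⟨?_, ?_⟩
  · rw [Sub.tail_lift]
    exact IsMor.wk hAt ht
  · rw [Sub.tail_lift, ← Expr.subst_subst]
    exact T.var_rule hAt

theorem isType_subst_lift {m n : ℕ} {Δ : Ctx S m} {Γ : Ctx S n} {A : Ty S n} {B : Ty S (n + 1)}
    (hΔ : T.WF Δ) (hB : T.Derivable (Γ.snoc A) (.isType B)) {t : Sub S n m} (ht : T.IsMor Δ Γ t) :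
    T.Derivable (Δ.snoc (A.subst t)) (.isType (B.subst t.lift)) :=
  have h : T.WF (Γ.snoc A) := wf_of_derivable hB
  subst_mor (wf_snoc_subst hΔ h ht) (ht.lift hΔ h.2) hB

end TypeTheory

/-! ### Fibrations -/

namespace TypeTheory

variable {S : Signature.{u}} {T : TypeTheory S}

namespace ClassifyingCategory

section Morphisms

variable {l m n : ℕ} {Θ : Ctx S l} {Δ : Ctx S m} {Γ : Ctx S n} {hΘ : T.WF Θ} {hΔ : T.WF Δ}
  {hΓ : T.WF Γ}

theorem exists_eq_mk (X : T.ClassifyingCategory) :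
    ∃ (n : ℕ) (Γ : Ctx S n) (hΓ : T.WF Γ), X = mk Γ hΓ := by
  obtain ⟨n, ⟨Γ, hΓ⟩⟩ := X
  exact ⟨n, Γ, hΓ, rfl⟩

theorem exists_eq_homMk (f : mk Δ hΔ ⟶ mk Γ hΓ) :
    ∃ (t : Sub S n m) (ht : T.IsMor Δ Γ t), f = homMk hΔ hΓ t ht := by
  obtain ⟨t, ht⟩ := f
  exact ⟨t, ht, rfl⟩

theorem homMk_eq_iff {s t : Sub S n m} {hs : T.IsMor Δ Γ s} {ht : T.IsMor Δ Γ t} :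
    homMk hΔ hΓ s hs = homMk hΔ hΓ t ht ↔ T.MorEq Δ Γ s t :=
  Quotient.eq.trans homEq_mk

theorem homMk_congr {s t : Sub S n m} {hs : T.IsMor Δ Γ s} (h : s = t) :
    homMk hΔ hΓ s hs = homMk hΔ hΓ t (h ▸ hs) := by
  subst h
  rfl

theorem homMk_comp {s : Sub S m l} {hs : T.IsMor Θ Δ s} {t : Sub S n m} {ht : T.IsMor Δ Γ t} :
    homMk hΘ hΔ s hs ≫ homMk hΔ hΓ t ht = homMk hΘ hΓ (t.comp s) (IsMor.comp hΘ ht hs) :=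
  rfl

theorem id_eq_homMk : 𝟙 (mk Γ hΓ) = homMk hΓ hΓ (Sub.id S n) (isMor_id hΓ) := rfl

theorem homMk_comp_proj {A : Ty S n} {h : T.WF (Γ.snoc A)} {s : Sub S (n + 1) m}
    {hs : T.IsMor Δ (Γ.snoc A) s} :
    homMk hΔ h s hs ≫ proj Γ A h = homMk hΔ h.1 s.tail hs.1 :=
  rfl

theorem isPullback_proj {A : Ty S n} (h : T.WF (Γ.snoc A)) {t : Sub S n m}
    (ht : T.IsMor Δ Γ t) :
    IsPullback (homMk (wf_snoc_subst hΔ h ht) h t.lift (ht.lift hΔ h.2))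
      (proj Δ (A.subst t) (wf_snoc_subst hΔ h ht)) (proj Γ A h) (homMk hΔ h.1 t ht) := by
  refine .mk' (homMk_congr (Sub.tail_lift t)) (fun W a b fst_eq snd_eq => ?_) fun W a b w => ?_
  all_goals
    obtain ⟨l, Θ, hΘ, rfl⟩ := exists_eq_mk W
    obtain ⟨a, ha, rfl⟩ := exists_eq_homMk a
    obtain ⟨b, hb, rfl⟩ := exists_eq_homMk b
  · have zero_eq : T.Derivable Θ (.eqTerm (a 0) (b 0) (A.subst (t.lift.comp a).tail)) :=
      (homMk_eq_iff.1 fst_eq).2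
    refine homMk_eq_iff.2 ⟨homMk_eq_iff.1 snd_eq, ?_⟩
    rwa [Sub.tail_lift_comp, ← Expr.subst_subst] at zero_eq
  · have tail_eq : T.MorEq Θ Γ a.tail (t.comp b) := homMk_eq_iff.1 w
    have ha₀ : T.Derivable Θ (.hasType (a 0) ((A.subst t).subst b)) := by
      rw [Expr.subst_subst]
      exact T.conv_hasType ha.2 (MorEq.subst_type hΘ ha.1 tail_eq h.2)
    refine ⟨homMk hΘ _ (b.cons (a 0)) (hb.cons ha₀), ?_, rfl⟩
    rw [homMk_comp, homMk_eq_iff, Sub.lift_comp_cons]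
    exact MorEq.symm hΘ h ha ⟨tail_eq, T.term_refl ha.2⟩

theorem isPullback_iso_hom_comp_proj {X : T.ClassifyingCategory} {A : Ty S n}
    (h : T.WF (Γ.snoc A)) {t : Sub S n m} (ht : T.IsMor Δ Γ t) (i : X ≅ mk (Γ.snoc A) h) :
    IsPullback (homMk (wf_snoc_subst hΔ h ht) h t.lift (ht.lift hΔ h.2) ≫ i.inv)
      (proj Δ (A.subst t) (wf_snoc_subst hΔ h ht)) (i.hom ≫ proj Γ A h) (homMk hΔ h.1 t ht) :=
  (isPullback_proj h ht).of_iso (Iso.refl _) i.symm (Iso.refl _) (Iso.refl _)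
    (by simp) (by simp) (by simp) (by simp)

theorem exists_iso_snoc {A : Ty S n} (h : T.WF (Γ.snoc A)) (e : mk Γ h.1 ≅ mk Δ hΔ) :
    ∃ (A' : Ty S m) (h' : T.WF (Δ.snoc A')) (i : mk (Γ.snoc A) h ≅ mk (Δ.snoc A') h'),
      i.hom ≫ proj Δ A' h' = proj Γ A h ≫ e.hom := by
  obtain ⟨t, ht, e_inv⟩ := exists_eq_homMk e.inv
  have sq := isPullback_proj (hΔ := hΔ) h ht
  rw [← e_inv] at sq
  have := sq.isIso_fst_of_isIso
  refine ⟨A.subst t, wf_snoc_subst hΔ h ht,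
    (asIso (homMk (wf_snoc_subst hΔ h ht) h t.lift (ht.lift hΔ h.2))).symm, ?_⟩
  rw [Iso.symm_hom, asIso_inv, IsIso.inv_comp_eq, reassoc_of% sq.w, e.inv_hom_id,
    Category.comp_id]

end Morphisms

end ClassifyingCategory

end TypeTheory

namespace StrongSums

open TypeTheory

variable {S : Signature.{u}} {T : TypeTheory S} (sums : StrongSums T)

/-- The substitution `(γ, p a b)` obtained from `w = (γ, a, b)`. -/
def pairSub {n m : ℕ} (A : Ty S n) (B : Ty S (n + 1)) (w : Sub S (n + 2) m) : Sub S (n + 1) m :=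
  w.tail.tail.cons
    (sums.pair (A.subst w.tail.tail) (B.subst w.tail.tail.lift) (w.tail 0) (w 0))

/-- The substitution `(γ, p₀ c, p₁ c)` obtained from `w = (γ, c)`. -/
def unpairSub {n m : ℕ} (A : Ty S n) (B : Ty S (n + 1)) (w : Sub S (n + 1) m) : Sub S (n + 2) m :=
  (w.tail.cons (sums.fst (A.subst w.tail) (B.subst w.tail.lift) (w 0))).cons
    (sums.snd (A.subst w.tail) (B.subst w.tail.lift) (w 0))

variable {l m n : ℕ} {Θ : Ctx S l} {Δ : Ctx S m} {Γ : Ctx S n} {A : Ty S n} {B : Ty S (n + 1)}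

theorem pairSub_comp (w : Sub S (n + 2) m) (s : Sub S m l) :
    (sums.pairSub A B w).comp s = sums.pairSub A B (w.comp s) := by
  simp only [pairSub, Sub.cons_comp, sums.pair_subst, Expr.subst_subst, Sub.lift_comp,
    Sub.tail_comp]
  rfl

theorem unpairSub_comp (w : Sub S (n + 1) m) (s : Sub S m l) :
    (sums.unpairSub A B w).comp s = sums.unpairSub A B (w.comp s) := by
  simp only [unpairSub, Sub.cons_comp, sums.fst_subst, sums.snd_subst, Expr.subst_subst,
    Sub.lift_comp, Sub.tail_comp]
  rfl

theorem wf_sigma (h : T.WF ((Γ.snoc A).snoc B)) : T.WF (Γ.snoc (sums.sigma A B)) :=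
  ⟨h.1.1, sums.sigma_form h.1.2 h.2⟩

theorem hasType_zero_subst_inst {w : Sub S (n + 2) m} (hw : T.IsMor Δ ((Γ.snoc A).snoc B) w) :
    T.Derivable Δ
      (.hasType (w 0) ((B.subst w.tail.tail.lift).subst (Sub.inst (w.tail 0)))) := by
  simpa using hw.2

theorem hasType_zero_sigma {w : Sub S (n + 1) m} (hw : T.IsMor Δ (Γ.snoc (sums.sigma A B)) w) :
    T.Derivable Δ
      (.hasType (w 0) (sums.sigma (A.subst w.tail) (B.subst w.tail.lift))) := by
  simpa only [sums.sigma_subst] using hw.2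

theorem isMor_pairSub (hΔ : T.WF Δ) (h : T.WF ((Γ.snoc A).snoc B)) {w : Sub S (n + 2) m}
    (hw : T.IsMor Δ ((Γ.snoc A).snoc B) w) :
    T.IsMor Δ (Γ.snoc (sums.sigma A B)) (sums.pairSub A B w) := by
  refine ⟨hw.1.1, ?_⟩
  rw [sums.sigma_subst]
  exact sums.pair_intro (isType_subst_lift hΔ h.2 hw.1.1) hw.1.2 (hasType_zero_subst_inst hw)

theorem isMor_unpairSub (hΔ : T.WF Δ) (h : T.WF ((Γ.snoc A).snoc B)) {w : Sub S (n + 1) m}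
    (hw : T.IsMor Δ (Γ.snoc (sums.sigma A B)) w) :
    T.IsMor Δ ((Γ.snoc A).snoc B) (sums.unpairSub A B w) := by
  have hB := isType_subst_lift hΔ h.2 hw.1
  refine ⟨⟨hw.1, sums.fst_elim hB (sums.hasType_zero_sigma hw)⟩, ?_⟩
  simpa [unpairSub] using sums.snd_elim hB (sums.hasType_zero_sigma hw)

theorem morEq_unpairSub_pairSub (hΔ : T.WF Δ) (h : T.WF ((Γ.snoc A).snoc B))
    {w : Sub S (n + 2) m} (hw : T.IsMor Δ ((Γ.snoc A).snoc B) w) :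
    T.MorEq Δ ((Γ.snoc A).snoc B) (sums.unpairSub A B (sums.pairSub A B w)) w := by
  have hB := isType_subst_lift hΔ h.2 hw.1.1
  refine .symm hΔ h hw ⟨⟨.refl hw.1.1, ?_⟩, ?_⟩
  · exact T.term_symm (sums.fst_pair hB hw.1.2 (hasType_zero_subst_inst hw))
  · simpa [unpairSub, pairSub] using
      T.term_symm (sums.snd_pair hB hw.1.2 (hasType_zero_subst_inst hw))

theorem morEq_pairSub_unpairSub (hΔ : T.WF Δ) (h : T.WF ((Γ.snoc A).snoc B))
    {w : Sub S (n + 1) m} (hw : T.IsMor Δ (Γ.snoc (sums.sigma A B)) w) :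
    T.MorEq Δ (Γ.snoc (sums.sigma A B)) (sums.pairSub A B (sums.unpairSub A B w)) w := by
  refine ⟨.refl hw.1, ?_⟩
  rw [sums.sigma_subst]
  exact sums.pair_eta (isType_subst_lift hΔ h.2 hw.1) (sums.hasType_zero_sigma hw)

end StrongSums

namespace TypeTheory.ClassifyingCategory

variable {S : Signature.{u}} {T : TypeTheory S} {n : ℕ} {Γ : Ctx S n}

section Sums

variable (sums : StrongSums T)

theorem isIso_proj_unit (h : T.WF (Γ.snoc sums.unit)) : IsIso (proj Γ sums.unit h) := by
  have var_eq_star : T.Derivable (Γ.snoc sums.unit) (.eqTerm (.var 0) sums.star sums.unit) :=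
    sums.unit_eta (by simpa only [sums.unit_subst] using T.var_rule h.2)
  refine ⟨homMk h.1 h (Sub.inst sums.star) (isMor_inst (sums.star_intro h.1)), ?_, rfl⟩
  rw [proj, homMk_comp, id_eq_homMk, homMk_eq_iff, Sub.inst_comp, sums.star_subst]
  refine MorEq.symm h h (isMor_id h) ⟨.refl (isMor_wk h), ?_⟩
  rwa [sums.unit_subst]

/-- The isomorphism `[Γ, x ∈ A, y ∈ B] ≅ [Γ, z ∈ Σ x ∈ A. B]`. -/
def sigmaIso {A : Ty S n} {B : Ty S (n + 1)} (h : T.WF ((Γ.snoc A).snoc B)) :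
    mk ((Γ.snoc A).snoc B) h ≅ mk (Γ.snoc (sums.sigma A B)) (sums.wf_sigma h) where
  hom := homMk h (sums.wf_sigma h) (sums.pairSub A B (Sub.id S _))
    (sums.isMor_pairSub h h (isMor_id h))
  inv := homMk (sums.wf_sigma h) h (sums.unpairSub A B (Sub.id S _))
    (sums.isMor_unpairSub (sums.wf_sigma h) h (isMor_id (sums.wf_sigma h)))
  hom_inv_id := by
    rw [homMk_comp, id_eq_homMk, homMk_eq_iff, sums.unpairSub_comp, Sub.id_comp]
    exact sums.morEq_unpairSub_pairSub h h (isMor_id h)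
  inv_hom_id := by
    rw [homMk_comp, id_eq_homMk, homMk_eq_iff, sums.pairSub_comp, Sub.id_comp]
    exact sums.morEq_pairSub_unpairSub (sums.wf_sigma h) h (isMor_id (sums.wf_sigma h))

theorem sigmaIso_hom_comp_proj {A : Ty S n} {B : Ty S (n + 1)} (h : T.WF ((Γ.snoc A).snoc B)) :
    (sigmaIso sums h).hom ≫ proj Γ (sums.sigma A B) (sums.wf_sigma h) =
      proj (Γ.snoc A) B h ≫ proj Γ A h.1 :=
  rfl

include sums in
theorem exists_iso_typeObj (X : T.ClassifyingCategory) :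
    ∃ (A : Ty S 0) (hA : T.Derivable .nil (.isType A)),
      Nonempty (X ≅ PropositionalIdTypes.typeObj hA) := by
  obtain ⟨n, Γ, hΓ, rfl⟩ := exists_eq_mk X
  induction Γ with
  | nil =>
    have h : T.WF (Ctx.nil.snoc sums.unit) := ⟨trivial, sums.unit_form trivial⟩
    have := isIso_proj_unit sums h
    exact ⟨sums.unit, h.2, ⟨(asIso (proj .nil sums.unit h)).symm⟩⟩
  | snoc Γ B ih =>
    obtain ⟨A, hA, ⟨e⟩⟩ := ih hΓ.1
    obtain ⟨B', h', i, -⟩ := exists_iso_snoc hΓ e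
    exact ⟨sums.sigma A B', (sums.wf_sigma h').2, ⟨i ≪≫ sigmaIso sums h'⟩⟩

end Sums

theorem isoClosure_displayMaps_iff {X : T.ClassifyingCategory} {hΓ : T.WF Γ} {p : X ⟶ mk Γ hΓ} :
    T.displayMaps.isoClosure p ↔
      ∃ (A : Ty S n) (h : T.WF (Γ.snoc A)) (i : X ≅ mk (Γ.snoc A) h), i.hom ≫ proj Γ A h = p := by
  constructor
  · rintro ⟨X', Y', p', hp', ⟨e⟩⟩
    obtain ⟨a, b, comm⟩ : ∃ (a : X' ≅ X) (b : Y' ≅ mk Γ hΓ), a.hom ≫ p = p' ≫ b.hom :=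
      ⟨Arrow.leftFunc.mapIso e, Arrow.rightFunc.mapIso e, Arrow.w e.hom⟩
    obtain ⟨Γ', A', h'⟩ := hp'
    obtain ⟨A, h, i, hi⟩ := exists_iso_snoc h' b
    refine ⟨A, h, a.symm ≪≫ i, ?_⟩
    rw [Iso.trans_hom, Category.assoc, hi, Iso.symm_hom, Iso.inv_comp_eq, comm]
  · rintro ⟨A, h, i, rfl⟩
    exact (MorphismProperty.cancel_left_of_respectsIso _ _ _).2
      (T.displayMaps.le_isoClosure _ (.proj Γ A h))

theorem fibrations_proj {A : Ty S n} (h : T.WF (Γ.snoc A)) : T.fibrations (proj Γ A h) :=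
  MorphismProperty.le_isoClosure _ _ (.of _ (.proj Γ A h))

instance : T.fibrations.RespectsIso :=
  MorphismProperty.isoClosure_respectsIso _

theorem nonempty_unique_hom_nil (X : T.ClassifyingCategory) :
    Nonempty (Unique (X ⟶ mk (T := T) .nil trivial)) := by
  obtain ⟨m, Δ, hΔ, rfl⟩ := exists_eq_mk X
  refine ⟨⟨⟨homMk (Γ := .nil) hΔ trivial (fun i => i.elim0) trivial⟩, fun f => ?_⟩⟩
  obtain ⟨f, hf, rfl⟩ := exists_eq_homMk f
  exact homMk_eq_iff.2 trivial

/-- The empty context is a terminal object. -/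
noncomputable def isTerminalNil : IsTerminal (mk (T := T) .nil trivial) :=
  have := fun X : T.ClassifyingCategory => (nonempty_unique_hom_nil X).some
  IsTerminal.ofUnique _

section FibrationsOfSums

variable (sums : StrongSums T)
include sums

theorem isMultiplicative_isoClosure_displayMaps :
    T.displayMaps.isoClosure.IsMultiplicative where
  id_mem X := by
    obtain ⟨n, Γ, hΓ, rfl⟩ := exists_eq_mk X
    have h : T.WF (Γ.snoc sums.unit) := ⟨hΓ, sums.unit_form hΓ⟩
    have := isIso_proj_unit sums h
    exact isoClosure_displayMaps_iff.2
      ⟨sums.unit, h, (asIso (proj Γ sums.unit h)).symm, by simp⟩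
  comp_mem {X Y Z} f g hf hg := by
    obtain ⟨n, Γ, hΓ, rfl⟩ := exists_eq_mk Z
    obtain ⟨A, h, i, rfl⟩ := isoClosure_displayMaps_iff.1 hg
    obtain ⟨B, h', j, hj⟩ := isoClosure_displayMaps_iff.1
      ((MorphismProperty.cancel_right_of_respectsIso _ f i.hom).2 hf)
    refine isoClosure_displayMaps_iff.2
      ⟨sums.sigma A B, sums.wf_sigma h', j ≪≫ sigmaIso sums h', ?_⟩
    rw [Iso.trans_hom, Category.assoc, sigmaIso_hom_comp_proj, reassoc_of% hj]

theorem fibrations_eq_isoClosure_displayMaps : T.fibrations = T.displayMaps.isoClosure := by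
  have := isMultiplicative_isoClosure_displayMaps sums
  refine le_antisymm ?_ ?_
  · rw [fibrations, dependentProjections, MorphismProperty.isoClosure_le_iff,
      MorphismProperty.multiplicativeClosure_le_iff]
    exact T.displayMaps.le_isoClosure
  · exact MorphismProperty.monotone_isoClosure T.displayMaps.le_multiplicativeClosure

theorem fibrations_iff {X : T.ClassifyingCategory} {hΓ : T.WF Γ} {p : X ⟶ mk Γ hΓ} :
    T.fibrations p ↔
      ∃ (A : Ty S n) (h : T.WF (Γ.snoc A)) (i : X ≅ mk (Γ.snoc A) h), i.hom ≫ proj Γ A h = p := by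
  rw [fibrations_eq_isoClosure_displayMaps sums, isoClosure_displayMaps_iff]

theorem isMultiplicative_fibrations : T.fibrations.IsMultiplicative := by
  rw [fibrations_eq_isoClosure_displayMaps sums]
  exact isMultiplicative_isoClosure_displayMaps sums

theorem hasPullback_of_fibrations {X Y Z : T.ClassifyingCategory} (p : X ⟶ Z) (f : Y ⟶ Z)
    (hp : T.fibrations p) : HasPullback p f := by
  obtain ⟨n, Γ, hΓ, rfl⟩ := exists_eq_mk Z
  obtain ⟨m, Δ, hΔ, rfl⟩ := exists_eq_mk Y
  obtain ⟨A, h, i, rfl⟩ := (fibrations_iff sums).1 hp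
  obtain ⟨t, ht, rfl⟩ := exists_eq_homMk f
  exact (isPullback_iso_hom_comp_proj h ht i).hasPullback

theorem isStableUnderBaseChange_of_le_fibrations (W : MorphismProperty T.ClassifyingCategory)
    [W.RespectsIso] (hW : W ≤ T.fibrations)
    (hW_proj : ∀ {m n : ℕ} {Δ : Ctx S m} {Γ : Ctx S n} {A : Ty S n} (hΔ : T.WF Δ)
      (h : T.WF (Γ.snoc A)) {t : Sub S n m} (ht : T.IsMor Δ Γ t),
      W (proj Γ A h) → W (proj Δ (A.subst t) (wf_snoc_subst hΔ h ht))) :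
    W.IsStableUnderBaseChange := by
  refine .of_forall_exists_isPullback fun {Y X Z} f p _ hp => ?_
  obtain ⟨n, Γ, hΓ, rfl⟩ := exists_eq_mk Z
  obtain ⟨m, Δ, hΔ, rfl⟩ := exists_eq_mk Y
  obtain ⟨A, h, i, rfl⟩ := (fibrations_iff sums).1 (hW p hp)
  obtain ⟨t, ht, rfl⟩ := exists_eq_homMk f
  exact ⟨_, _, _, (isPullback_iso_hom_comp_proj h ht i).flip,
    hW_proj hΔ h ht ((W.cancel_left_of_respectsIso i.hom _).1 hp)⟩

theorem isStableUnderBaseChange_fibrations : T.fibrations.IsStableUnderBaseChange :=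
  isStableUnderBaseChange_of_le_fibrations sums _ le_rfl fun _ _ _ _ _ => fibrations_proj _

theorem fibrations_of_isTerminal {X Z : T.ClassifyingCategory} (f : X ⟶ Z) (hZ : IsTerminal Z) :
    T.fibrations f := by
  have := isMultiplicative_fibrations sums
  obtain ⟨n, Γ, hΓ, rfl⟩ := exists_eq_mk X
  induction Γ with
  | nil =>
    have : IsIso f := isIso_of_isTerminal isTerminalNil hZ f
    exact T.fibrations.of_isIso f
  | snoc Γ A ih =>
    rw [hZ.hom_ext f (proj Γ A hΓ ≫ hZ.from _)]
    exact T.fibrations.comp_mem _ _ (fibrations_proj hΓ) (ih hΓ.1 _)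

end FibrationsOfSums

end TypeTheory.ClassifyingCategory

/-! ### Path induction -/

namespace TypeTheory

variable {S : Signature.{u}} {T : TypeTheory S} {m n : ℕ} {Δ : Ctx S m} {Γ : Ctx S n} {A B : Ty S n}

variable (T) in
/-- The type `A` is inhabited in the context `Γ`. -/
def HasElement (Γ : Ctx S n) (A : Ty S n) : Prop :=
  ∃ a, T.Derivable Γ (.hasType a A)

theorem HasElement.conv (h : T.HasElement Γ A) (hAB : T.Derivable Γ (.eqType A B)) :
    T.HasElement Γ B :=
  h.imp fun _ ha => T.conv_hasType ha hAB

theorem HasElement.subst (h : T.HasElement Γ A) (hΔ : T.WF Δ) {s : Sub S n m}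
    (hs : T.IsMor Δ Γ s) : T.HasElement Δ (A.subst s) :=
  h.elim fun a ha => ⟨a.subst s, subst_mor hΔ hs ha⟩

end TypeTheory

namespace PropositionalIdTypes

open TypeTheory TypeTheory.ClassifyingCategory

variable {S : Signature.{u}} {T : TypeTheory S} (I : PropositionalIdTypes T)

section PathInduction

variable {m n : ℕ} {Δ : Ctx S m} {Γ : Ctx S n} {A : Ty S n}

variable (S n) in
/-- The projection `(γ, x, y, u) ↦ (γ, x)`. -/
def idFst : Sub S (n + 1) (n + 3) :=
  (Sub.wk S (n + 2)).tail

variable (S n) in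
/-- The projection `(γ, x, y, u) ↦ (γ, y)`. -/
def idSnd : Sub S (n + 1) (n + 3) :=
  (Sub.wk S (n + 2)).tail.tail.cons (.var 1)

theorem isMor_idFst (hA : T.Derivable Γ (.isType A)) :
    T.IsMor (idCtx I.Id Γ A) (Γ.snoc A) (idFst S n) :=
  (isMor_wk (I.wf_idCtx hA)).1

theorem isMor_idSnd (hA : T.Derivable Γ (.isType A)) :
    T.IsMor (idCtx I.Id Γ A) (Γ.snoc A) (idSnd S n) := by
  refine ⟨(I.isMor_idFst hA).1, ?_⟩
  have hy : T.Derivable (idCtx I.Id Γ A) (.hasType (.var 1)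
      (((A.subst (Sub.wk S n)).subst (Sub.wk S (n + 1))).subst (Sub.wk S (n + 2)))) :=
    weaken (T.var_rule (weaken hA hA)) (I.wf_idCtx hA).2
  simpa [idSnd] using hy

@[simp]
theorem idFst_comp_idDiag : (idFst S n).comp (idDiag I.r A) = Sub.id S (n + 1) :=
  Sub.cons_tail (Sub.id S (n + 1))

@[simp]
theorem idSnd_comp_idDiag : (idSnd S n).comp (idDiag I.r A) = Sub.id S (n + 1) := by
  rw [idSnd, Sub.cons_comp]
  exact Sub.cons_tail (Sub.id S (n + 1))

@[simp]
theorem idFst_comp_idInst (a b p : Tm S n) : (idFst S n).comp (idInst a b p) = Sub.inst a :=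
  rfl

@[simp]
theorem idSnd_comp_idInst (a b p : Tm S n) : (idSnd S n).comp (idInst a b p) = Sub.inst b := by
  rw [idSnd, Sub.cons_comp]
  rfl

theorem isMor_idDiag (hA : T.Derivable Γ (.isType A)) :
    T.IsMor (Γ.snoc A) (idCtx I.Id Γ A) (idDiag I.r A) := by
  have hx := T.var_rule hA
  refine ⟨⟨⟨isMor_wk ⟨wf_of_derivable hA, hA⟩, hx⟩, ?_⟩, ?_⟩
  · rw [Expr.subst_subst]
    exact hx
  · rw [I.Id_subst, Expr.subst_subst, Expr.subst_subst]
    exact I.r_intro hx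

theorem isMor_lift_idCtx (hΔ : T.WF Δ) {s : Sub S n m} (hs : T.IsMor Δ Γ s)
    (hA : T.Derivable Γ (.isType A)) :
    T.IsMor (idCtx I.Id Δ (A.subst s)) (idCtx I.Id Γ A) s.lift.lift.lift := by
  have hw := I.wf_idCtx (subst_mor hΔ hs hA : T.Derivable Δ (.isType (A.subst s)))
  have hxy := (hs.lift hΔ hA).lift hw.1.1 (I.wf_idCtx hA).1.2
  rw [Expr.subst_wk_subst_lift] at hxy
  have hxyu := hxy.lift hw.1 (I.wf_idCtx hA).2
  rw [I.Id_subst, Expr.subst_wk_subst_lift, Expr.subst_wk_subst_lift] at hxyu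
  exact hxyu

theorem lift_comp_idDiag (s : Sub S n m) :
    s.lift.lift.lift.comp (idDiag I.r (A.subst s)) = (idDiag I.r A).comp s.lift := by
  simp only [idDiag, Sub.lift_comp_cons, Sub.cons_comp, I.r_subst, Expr.subst_subst, Sub.wk_comp,
    Sub.tail_lift]
  rfl

theorem subst_idFst_subst_idDiag (B : Ty S (n + 1)) :
    (B.subst (idFst S n)).subst (idDiag I.r A) = B := by
  rw [Expr.subst_subst, idFst_comp_idDiag, Expr.subst_id]

theorem subst_idSnd_subst_idDiag (B : Ty S (n + 1)) :
    (B.subst (idSnd S n)).subst (idDiag I.r A) = B := by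
  rw [Expr.subst_subst, idSnd_comp_idDiag, Expr.subst_id]

theorem subst_idFst_subst_idInst (B : Ty S (n + 1)) (a b p : Tm S n) :
    (B.subst (idFst S n)).subst (idInst a b p) = B.subst (Sub.inst a) := by
  rw [Expr.subst_subst, idFst_comp_idInst]

theorem subst_idSnd_subst_idInst (B : Ty S (n + 1)) (a b p : Tm S n) :
    (B.subst (idSnd S n)).subst (idInst a b p) = B.subst (Sub.inst b) := by
  rw [Expr.subst_subst, idSnd_comp_idInst]

/-- With `B(x)` as parameter context, path induction yields transport without function types. -/
theorem hasElement_transport {B : Ty S (n + 1)} {a b : Tm S n}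
    (hB : T.Derivable (Γ.snoc A) (.isType B)) (ha : T.Derivable Γ (.hasType a A))
    (hb : T.Derivable Γ (.hasType b A)) (hab : T.HasElement Γ (I.Id A a b))
    (hBa : T.HasElement Γ (B.subst (Sub.inst a))) : T.HasElement Γ (B.subst (Sub.inst b)) := by
  obtain ⟨p, hp⟩ := hab
  obtain ⟨v, hv⟩ := hBa
  have hA := T.presup_hasType ha
  have hw := I.wf_idCtx hA
  have hBx : T.Derivable (idCtx I.Id Γ A) (.isType (B.subst (idFst S n))) :=
    subst_mor hw (I.isMor_idFst hA) hB
  have hBy : T.Derivable (idCtx I.Id Γ A) (.isType (B.subst (idSnd S n))) :=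
    subst_mor hw (I.isMor_idSnd hA) hB
  have base : T.Derivable ((Γ.snoc A).snoc ((B.subst (idFst S n)).subst (idDiag I.r A)))
      (.hasType (.var 0)
        (((B.subst (idSnd S n)).subst (Sub.wk S (n + 3))).subst (idDiag I.r A).lift)) := by
    rw [Expr.subst_wk_subst_lift, subst_idFst_subst_idDiag, subst_idSnd_subst_idDiag]
    exact T.var_rule hB
  have transport : T.HasElement (Γ.snoc ((B.subst (idFst S n)).subst (idInst a b p)))
      (((B.subst (idSnd S n)).subst (Sub.wk S (n + 3))).subst (idInst a b p).lift) :=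
    ⟨_, I.J_elim (k := 1) (Ξ := .cons (B.subst (idFst S n)) .nil) (weaken hBy hBx) ha hb hp base⟩
  rw [Expr.subst_wk_subst_lift, subst_idFst_subst_idInst, subst_idSnd_subst_idInst] at transport
  have hBb := transport.subst (wf_of_derivable hv) (isMor_inst hv)
  rwa [Expr.subst_wk_subst_inst] at hBb

variable (S n) in
/-- The projection `(γ, x, y, u) ↦ γ`. -/
def idBase : Sub S n (n + 3) :=
  (idFst S n).tail

theorem lift_idBase_comp_idInst_vars :
    (idBase S n).lift.lift.lift.comp (idInst (.var 2) (.var 1) (.var 0)) = Sub.id S (n + 3) := by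
  simp only [idInst, Sub.lift_comp_cons, Sub.comp_id]
  rw [show (idBase S n).cons (.var 2) = idFst S n from Sub.cons_tail _,
    show (idFst S n).cons (.var 1) = Sub.wk S (n + 2) from Sub.cons_tail _]
  exact Sub.cons_tail (Sub.id S (n + 3))

theorem hasType_idCtx_path (hA : T.Derivable Γ (.isType A)) :
    T.Derivable (idCtx I.Id Γ A)
      (.hasType (.var 0) (I.Id (A.subst (idBase S n)) (.var 2) (.var 1))) := by
  have weaken_id : (I.Id ((A.subst (Sub.wk S n)).subst (Sub.wk S (n + 1))) (.var 1) (.var 0)).subst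
      (Sub.wk S (n + 2)) = I.Id (A.subst (idBase S n)) (.var 2) (.var 1) := by
    rw [I.Id_subst, Expr.subst_subst, Expr.subst_subst]
    rfl
  rw [← weaken_id]
  exact T.var_rule (I.wf_idCtx hA).2

theorem hasElement_idCtx {C : Ty S (n + 3)} (hC : T.Derivable (idCtx I.Id Γ A) (.isType C))
    (hd : T.HasElement (Γ.snoc A) (C.subst (idDiag I.r A))) :
    T.HasElement (idCtx I.Id Γ A) C := by
  have hA : T.Derivable Γ (.isType A) := T.presup_ctx (T.presup_ctx (T.presup_ctx hC))
  have hw := I.wf_idCtx hA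
  have hbase : T.IsMor (idCtx I.Id Γ A) Γ (idBase S n) := (I.isMor_idFst hA).1
  have hC' : T.Derivable (idCtx I.Id (idCtx I.Id Γ A) (A.subst (idBase S n)))
      (.isType (C.subst (idBase S n).lift.lift.lift)) :=
    subst_mor (I.wf_idCtx (subst_mor hw hbase hA)) (I.isMor_lift_idCtx hw hbase hA) hC
  obtain ⟨d, hd'⟩ := hd.subst (wf_snoc_subst hw hw.1.1 hbase) (hbase.lift hw hA)
  rw [Expr.subst_subst, ← I.lift_comp_idDiag, ← Expr.subst_subst] at hd'
  have generic : T.HasElement (idCtx I.Id Γ A)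
      ((C.subst (idBase S n).lift.lift.lift).subst (idInst (.var 2) (.var 1) (.var 0))) :=
    ⟨_, I.J_elim (k := 0) (Ξ := .nil) (A := A.subst (idBase S n))
      (C := C.subst (idBase S n).lift.lift.lift) hC' (I.isMor_idFst hA).2
      (I.isMor_idSnd hA).2 (I.hasType_idCtx_path hA) hd'⟩
  rwa [Expr.subst_subst, lift_idBase_comp_idInst_vars, Expr.subst_id] at generic

end PathInduction

end PropositionalIdTypes

/-! ### Propositional equality and homotopy -/

namespace PropositionalIdTypes

open TypeTheory TypeTheory.ClassifyingCategory

variable {S : Signature.{u}} {T : TypeTheory S} (I : PropositionalIdTypes T)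

section PropositionalEquality

variable {m n : ℕ} {Δ : Ctx S m} {Γ : Ctx S n}

theorem Id_wk_subst_inst (A : Ty S n) (a : Tm S n) (c : Tm S (n + 1)) (x : Tm S n) :
    (I.Id (A.subst (Sub.wk S n)) (a.subst (Sub.wk S n)) c).subst (Sub.inst x) =
      I.Id A a (c.subst (Sub.inst x)) := by
  rw [I.Id_subst, Expr.subst_wk_subst_inst, Expr.subst_wk_subst_inst]

/-- Propositional equality of the terms `a` and `b` of type `A` in the context `Γ`. -/
structure PropEq (Γ : Ctx S n) (A : Ty S n) (a b : Tm S n) : Prop where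
  left : T.Derivable Γ (.hasType a A)
  right : T.Derivable Γ (.hasType b A)
  hasElement : T.HasElement Γ (I.Id A a b)

namespace PropEq

variable {I} {A : Ty S n} {a b c : Tm S n}

theorem refl (ha : T.Derivable Γ (.hasType a A)) : I.PropEq Γ A a a :=
  ⟨ha, ha, _, I.r_intro ha⟩

theorem symm (h : I.PropEq Γ A a b) : I.PropEq Γ A b a := by
  have hA := T.presup_hasType h.left
  have subst_inst_eq (x : Tm S n) :
      (I.Id (A.subst (Sub.wk S n)) (.var 0) (a.subst (Sub.wk S n))).subst (Sub.inst x) =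
        I.Id A x a := by
    rw [I.Id_subst, Expr.subst_wk_subst_inst, Expr.subst_wk_subst_inst, Expr.var_subst,
      Sub.inst_zero]
  have transport := I.hasElement_transport (I.Id_form (T.var_rule hA) (weaken h.left hA))
    h.left h.right h.hasElement
  simp only [subst_inst_eq] at transport
  exact ⟨h.right, h.left, transport ⟨_, I.r_intro h.left⟩⟩

theorem trans (h : I.PropEq Γ A a b) (h' : I.PropEq Γ A b c) : I.PropEq Γ A a c := by
  have hA := T.presup_hasType h.left
  have transport := I.hasElement_transport (I.Id_form (weaken h.left hA) (T.var_rule hA))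
    h'.left h'.right h'.hasElement
  simp only [Id_wk_subst_inst, Expr.var_subst, Sub.inst_zero] at transport
  exact ⟨h.left, h'.right, transport h.hasElement⟩

theorem subst (h : I.PropEq Γ A a b) (hΔ : T.WF Δ) {s : Sub S n m}
    (hs : T.IsMor Δ Γ s) : I.PropEq Δ (A.subst s) (a.subst s) (b.subst s) where
  left := subst_mor hΔ hs h.left
  right := subst_mor hΔ hs h.right
  hasElement := by
    rw [← I.Id_subst]
    exact h.hasElement.subst hΔ hs

theorem transport {A : Ty S n} {s : Sub S n m} {a b : Tm S m} (h : I.PropEq Δ (A.subst s) a b)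
    (hs : T.IsMor Δ Γ s) {B : Ty S (n + 1)} (hB : T.Derivable (Γ.snoc A) (.isType B))
    (hBa : T.HasElement Δ (B.subst (s.cons a))) : T.HasElement Δ (B.subst (s.cons b)) := by
  have := I.hasElement_transport (isType_subst_lift (wf_of_derivable h.left) hB hs)
    h.left h.right h.hasElement
  simp only [Expr.subst_subst, Sub.lift_comp_inst] at this
  exact this hBa

theorem map {A B : Ty S n} {s : Sub S n m} {a b : Tm S m} (h : I.PropEq Δ (A.subst s) a b)
    (hs : T.IsMor Δ Γ s) {c : Tm S (n + 1)}
    (hc : T.Derivable (Γ.snoc A) (.hasType c (B.subst (Sub.wk S n)))) :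
    I.PropEq Δ (B.subst s) (c.subst (s.cons a)) (c.subst (s.cons b)) := by
  have hΔ := wf_of_derivable h.left
  have hA := T.presup_hasType h.left
  have hasType_map {x : Tm S m} (hx : T.Derivable Δ (.hasType x (A.subst s))) :
      T.Derivable Δ (.hasType (c.subst (s.cons x)) (B.subst s)) := by
    have : T.Derivable Δ
        (.hasType (c.subst (s.cons x)) ((B.subst (Sub.wk S n)).subst (s.cons x))) :=
      subst_mor hΔ (hs.cons hx) hc
    rwa [Expr.subst_subst, Sub.wk_comp, Sub.tail_cons] at this
  have hc' : T.Derivable (Δ.snoc (A.subst s))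
      (.hasType (c.subst s.lift) ((B.subst s).subst (Sub.wk S m))) := by
    rw [← Expr.subst_wk_subst_lift]
    have hw : T.WF (Δ.snoc (A.subst s)) := ⟨hΔ, hA⟩
    exact subst_mor hw (hs.lift hΔ (wf_of_derivable hc).2) hc
  have transport := I.hasElement_transport (I.Id_form (weaken (hasType_map h.left) hA) hc')
    h.left h.right h.hasElement
  rw [Id_wk_subst_inst, Id_wk_subst_inst, Expr.subst_subst, Expr.subst_subst, Sub.lift_comp_inst,
    Sub.lift_comp_inst] at transport
  exact ⟨hasType_map h.left, hasType_map h.right, transport ⟨_, I.r_intro (hasType_map h.left)⟩⟩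

end PropEq

end PropositionalEquality

section PathHomotopy

variable {m n : ℕ} {Δ : Ctx S m} {Γ : Ctx S n} {hΔ : T.WF Δ} {hΓ : T.WF Γ} {A B : Ty S 0}
  {hA : T.Derivable .nil (.isType A)} {hB : T.Derivable .nil (.isType B)}

theorem isMor_const {a : Tm S m} (ha : T.Derivable Δ (.hasType a (A.ofClosed m))) :
    T.IsMor Δ (Ctx.nil.snoc A) (fun _ => a) :=
  ⟨trivial, by rwa [Expr.subst_eq_ofClosed]⟩

variable (hΔ hA) in
/-- The morphism `Δ ⟶ [x ∈ A]` given by an element of the closed type `A` in the context `Δ`. -/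
def termHom {a : Tm S m} (ha : T.Derivable Δ (.hasType a (A.ofClosed m))) :
    ClassifyingCategory.mk Δ hΔ ⟶ typeObj hA :=
  homMk hΔ (wf_nil_snoc hA) (fun _ => a) (isMor_const ha)

theorem exists_eq_termHom (f : ClassifyingCategory.mk Δ hΔ ⟶ typeObj hA) :
    ∃ (a : Tm S m) (ha : T.Derivable Δ (.hasType a (A.ofClosed m))), f = termHom hΔ hA ha := by
  obtain ⟨t, ht, rfl⟩ := exists_eq_homMk (hΓ := wf_nil_snoc hA) f
  have ht₀ : T.Derivable Δ (.hasType (t 0) (A.ofClosed m)) := by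
    simpa only [Expr.subst_eq_ofClosed] using ht.2
  exact ⟨t 0, ht₀, homMk_congr (funext fun i => congrArg t (Fin.fin_one_eq_zero i))⟩

theorem hasType_subst_ofClosed (hΔ : T.WF Δ) {a : Tm S n}
    (ha : T.Derivable Γ (.hasType a (A.ofClosed n))) {s : Sub S n m} (hs : T.IsMor Δ Γ s) :
    T.Derivable Δ (.hasType (a.subst s) (A.ofClosed m)) := by
  rw [← A.ofClosed_subst s]
  exact subst_mor hΔ hs ha

theorem homMk_comp_termHom {a : Tm S n} (ha : T.Derivable Γ (.hasType a (A.ofClosed n)))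
    {s : Sub S n m} (hs : T.IsMor Δ Γ s) :
    homMk hΔ hΓ s hs ≫ termHom hΓ hA ha = termHom hΔ hA (hasType_subst_ofClosed hΔ ha hs) :=
  rfl

/-- Two maps into `[x ∈ A]` are path homotopic if they are joined by a map into
`[x ∈ A, y ∈ A, u ∈ Id_A(x, y)]`, that is, if they are homotopic without identifying the codomain
with another closed type. -/
def PathHomotopic (hA : T.Derivable .nil (.isType A)) {X : T.ClassifyingCategory}
    (f g : X ⟶ typeObj hA) : Prop :=
  ∃ h : X ⟶ I.pathObj hA, h ≫ I.src hA = f ∧ h ≫ I.tgt hA = g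

theorem Id_vars_subst {w : Sub S 3 m} :
    (I.Id ((A.subst (Sub.wk S 0)).subst (Sub.wk S 1)) (.var 1) (.var 0)).subst w.tail =
      I.Id (A.ofClosed m) (w 2) (w 1) := by
  rw [I.Id_subst, Expr.subst_eq_ofClosed, Expr.ofClosed_subst, Expr.ofClosed_subst]
  rfl

theorem pathHomotopic_termHom_iff {a b : Tm S m} {ha : T.Derivable Δ (.hasType a (A.ofClosed m))}
    {hb : T.Derivable Δ (.hasType b (A.ofClosed m))} :
    I.PathHomotopic hA (termHom hΔ hA ha) (termHom hΔ hA hb) ↔ I.PropEq Δ (A.ofClosed m) a b := by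
  constructor
  · rintro ⟨h, src_eq, tgt_eq⟩
    obtain ⟨w, hw, rfl⟩ := exists_eq_homMk (hΓ := I.wf_idCtx hA) h
    have hw₀ := hw.2
    rw [Id_vars_subst] at hw₀
    have src_eq' : T.MorEq Δ (Ctx.nil.snoc A) (fun _ => w 2) (fun _ => a) := homMk_eq_iff.1 src_eq
    have tgt_eq' : T.MorEq Δ (Ctx.nil.snoc A) (fun _ => w 1) (fun _ => b) := homMk_eq_iff.1 tgt_eq
    have hwa := src_eq'.2
    have hwb := tgt_eq'.2
    rw [Expr.subst_eq_ofClosed] at hwa hwb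
    exact ⟨ha, hb, _, T.conv_hasType hw₀ (I.Id_congr (T.type_refl (T.presup_hasType ha)) hwa hwb)⟩
  · rintro ⟨-, -, p, hp⟩
    have hw : T.IsMor Δ (idCtx I.Id .nil A) ((Sub.cons (n := 1) (fun _ => a) b).cons p) := by
      refine ⟨⟨isMor_const ha, ?_⟩, ?_⟩
      · rw [Expr.subst_eq_ofClosed, Expr.ofClosed_subst]
        exact hb
      · rw [Id_vars_subst]
        exact hp
    exact ⟨homMk hΔ (I.wf_idCtx hA) _ hw, rfl, rfl⟩

namespace PathHomotopic

variable {I} {X : T.ClassifyingCategory} {f g k : X ⟶ typeObj hA}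

theorem refl (f : X ⟶ typeObj hA) : I.PathHomotopic hA f f := by
  obtain ⟨m, Δ, hΔ, rfl⟩ := exists_eq_mk X
  obtain ⟨a, ha, rfl⟩ := exists_eq_termHom f
  exact I.pathHomotopic_termHom_iff.2 (.refl ha)

theorem symm (h : I.PathHomotopic hA f g) : I.PathHomotopic hA g f := by
  obtain ⟨m, Δ, hΔ, rfl⟩ := exists_eq_mk X
  obtain ⟨a, ha, rfl⟩ := exists_eq_termHom f
  obtain ⟨b, hb, rfl⟩ := exists_eq_termHom g
  exact I.pathHomotopic_termHom_iff.2 (I.pathHomotopic_termHom_iff.1 h).symm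

theorem trans (h : I.PathHomotopic hA f g) (h' : I.PathHomotopic hA g k) :
    I.PathHomotopic hA f k := by
  obtain ⟨m, Δ, hΔ, rfl⟩ := exists_eq_mk X
  obtain ⟨a, ha, rfl⟩ := exists_eq_termHom f
  obtain ⟨b, hb, rfl⟩ := exists_eq_termHom g
  obtain ⟨c, hc, rfl⟩ := exists_eq_termHom k
  exact I.pathHomotopic_termHom_iff.2
    ((I.pathHomotopic_termHom_iff.1 h).trans (I.pathHomotopic_termHom_iff.1 h'))

theorem precomp {W : T.ClassifyingCategory} (k : W ⟶ X) (h : I.PathHomotopic hA f g) :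
    I.PathHomotopic hA (k ≫ f) (k ≫ g) := by
  obtain ⟨h, rfl, rfl⟩ := h
  exact ⟨k ≫ h, Category.assoc _ _ _, Category.assoc _ _ _⟩

theorem postcomp (h : I.PathHomotopic hA f g) (k : typeObj hA ⟶ typeObj hB) :
    I.PathHomotopic hB (f ≫ k) (g ≫ k) := by
  obtain ⟨m, Δ, hΔ, rfl⟩ := exists_eq_mk X
  obtain ⟨a, ha, rfl⟩ := exists_eq_termHom f
  obtain ⟨b, hb, rfl⟩ := exists_eq_termHom g
  obtain ⟨c, hc, rfl⟩ := exists_eq_termHom (hΔ := wf_nil_snoc hA) k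
  have hc' : T.Derivable (Ctx.nil.snoc A) (.hasType c (B.subst (Sub.wk S 0))) := by
    rwa [Expr.subst_eq_ofClosed]
  have hab : I.PropEq Δ (A.subst fun i => i.elim0) a b := I.pathHomotopic_termHom_iff.1 h
  have hcab := hab.map (Γ := .nil) trivial hc'
  rw [Sub.cons_eq_const, Sub.cons_eq_const] at hcab
  exact (I.pathHomotopic_termHom_iff (ha := hcab.left) (hb := hcab.right)).2 hcab

end PathHomotopic

end PathHomotopy

end PropositionalIdTypes

/-! ### Homotopy equivalences -/

theorem isIso_of_two_out_of_six {C : Type u} [Category.{v} C] {W X Y Z : C} (f : W ⟶ X)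
    (g : X ⟶ Y) (h : Y ⟶ Z) [IsIso (f ≫ g)] [IsIso (g ≫ h)] : IsIso f ∧ IsIso g ∧ IsIso h := by
  have : Mono g := mono_of_mono g h
  have : IsSplitEpi g := ⟨⟨⟨inv (f ≫ g) ≫ f, by rw [Category.assoc, IsIso.inv_hom_id]⟩⟩⟩
  have : IsIso g := isIso_of_mono_of_isSplitEpi g
  exact ⟨.of_isIso_comp_right f g, this, .of_isIso_comp_left g h⟩

namespace PropositionalIdTypes

open TypeTheory TypeTheory.ClassifyingCategory

variable {S : Signature.{u}} {T : TypeTheory S} {I : PropositionalIdTypes T}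

namespace Homotopic

variable {W X Y Z : T.ClassifyingCategory} {f g k : X ⟶ Y}

theorem of_pathHomotopic {A : Ty S 0} {hA : T.Derivable .nil (.isType A)} (e : Y ≅ typeObj hA)
    (h : I.PathHomotopic hA (f ≫ e.hom) (g ≫ e.hom)) : I.Homotopic f g :=
  ⟨A, hA, e, h⟩

theorem exists_pathHomotopic (h : I.Homotopic f g) :
    ∃ (A : Ty S 0) (hA : T.Derivable .nil (.isType A)) (e : Y ≅ typeObj hA),
      I.PathHomotopic hA (f ≫ e.hom) (g ≫ e.hom) :=
  h

theorem pathHomotopic (h : I.Homotopic f g) {A : Ty S 0} {hA : T.Derivable .nil (.isType A)}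
    (e : Y ≅ typeObj hA) : I.PathHomotopic hA (f ≫ e.hom) (g ≫ e.hom) := by
  obtain ⟨B, hB, e', h⟩ := h.exists_pathHomotopic
  simpa only [Category.assoc, Iso.hom_inv_id_assoc] using h.postcomp (e'.inv ≫ e.hom)

theorem refl (sums : StrongSums T) (f : X ⟶ Y) : I.Homotopic f f := by
  obtain ⟨A, hA, ⟨e⟩⟩ := exists_iso_typeObj sums Y
  exact of_pathHomotopic e (.refl _)

theorem symm (h : I.Homotopic f g) : I.Homotopic g f := by
  obtain ⟨A, hA, e, h⟩ := h.exists_pathHomotopic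
  exact of_pathHomotopic e h.symm

theorem trans (h : I.Homotopic f g) (h' : I.Homotopic g k) : I.Homotopic f k := by
  obtain ⟨A, hA, e, h⟩ := h.exists_pathHomotopic
  exact of_pathHomotopic e (h.trans (h'.pathHomotopic e))

theorem precomp (k : W ⟶ X) (h : I.Homotopic f g) : I.Homotopic (k ≫ f) (k ≫ g) := by
  obtain ⟨A, hA, e, h⟩ := h.exists_pathHomotopic
  refine of_pathHomotopic e ?_
  simpa only [Category.assoc] using h.precomp k

theorem postcomp (sums : StrongSums T) (h : I.Homotopic f g) (k : Y ⟶ Z) :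
    I.Homotopic (f ≫ k) (g ≫ k) := by
  obtain ⟨A, hA, e, h⟩ := h.exists_pathHomotopic
  obtain ⟨B, hB, ⟨e'⟩⟩ := exists_iso_typeObj sums Z
  refine of_pathHomotopic e' ?_
  simpa only [Category.assoc, Iso.hom_inv_id_assoc] using h.postcomp (e.inv ≫ k ≫ e'.hom)

end Homotopic

section HomotopyCategory

variable (I) in
/-- Homotopy as a relation on the hom-sets of the classifying category. -/
def homotopyRel : HomRel T.ClassifyingCategory :=
  fun _ _ => I.Homotopic

variable (I) in
/-- The quotient functor to the homotopy category, in which homotopic maps are identified. -/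
def toHomotopyCategory : T.ClassifyingCategory ⥤ CategoryTheory.Quotient I.homotopyRel :=
  Quotient.functor _

instance : I.toHomotopyCategory.Full :=
  inferInstanceAs (Quotient.functor _).Full

variable (sums : StrongSums T)
include sums

theorem congruence_homotopyRel : Congruence I.homotopyRel where
  equivalence := ⟨.refl sums, .symm, .trans⟩
  comp_left f _ _ h := h.precomp f
  comp_right g h := h.postcomp sums g

variable {X Y : T.ClassifyingCategory}

theorem toHomotopyCategory_map_eq_iff {f g : X ⟶ Y} :
    I.toHomotopyCategory.map f = I.toHomotopyCategory.map g ↔ I.Homotopic f g :=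
  have := congruence_homotopyRel (I := I) sums
  Quotient.functor_map_eq_iff I.homotopyRel f g

theorem homotopyEquivalences_eq_inverseImage :
    I.homotopyEquivalences =
      (MorphismProperty.isomorphisms _).inverseImage I.toHomotopyCategory := by
  ext X Y f
  constructor
  · rintro ⟨g, hfg, hgf⟩
    rw [← toHomotopyCategory_map_eq_iff sums, Functor.map_comp,
      CategoryTheory.Functor.map_id] at hfg hgf
    exact ⟨I.toHomotopyCategory.map g, hfg, hgf⟩
  · rintro ⟨g', hfg, hgf⟩
    obtain ⟨g, rfl⟩ := I.toHomotopyCategory.map_surjective g'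
    rw [← Functor.map_comp, ← CategoryTheory.Functor.map_id,
      toHomotopyCategory_map_eq_iff sums] at hfg hgf
    exact ⟨g, hfg, hgf⟩

theorem homotopyEquivalences_iff {f : X ⟶ Y} :
    I.homotopyEquivalences f ↔ IsIso (I.toHomotopyCategory.map f) := by
  rw [homotopyEquivalences_eq_inverseImage sums]
  rfl

theorem isMultiplicative_homotopyEquivalences : I.homotopyEquivalences.IsMultiplicative := by
  rw [homotopyEquivalences_eq_inverseImage sums]
  infer_instance

theorem respectsIso_homotopyEquivalences : I.homotopyEquivalences.RespectsIso := by
  rw [homotopyEquivalences_eq_inverseImage sums]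
  infer_instance

theorem homotopyEquivalences_two_out_of_six {W X Y Z : T.ClassifyingCategory} (f : W ⟶ X)
    (g : X ⟶ Y) (h : Y ⟶ Z) (hfg : I.homotopyEquivalences (f ≫ g))
    (hgh : I.homotopyEquivalences (g ≫ h)) :
    I.homotopyEquivalences f ∧ I.homotopyEquivalences g ∧ I.homotopyEquivalences h ∧
      I.homotopyEquivalences (f ≫ g ≫ h) := by
  simp only [homotopyEquivalences_iff sums, Functor.map_comp] at hfg hgh ⊢
  obtain ⟨hf, hg, hh⟩ := isIso_of_two_out_of_six (I.toHomotopyCategory.map f)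
    (I.toHomotopyCategory.map g) (I.toHomotopyCategory.map h)
  exact ⟨hf, hg, hh, inferInstance⟩

end HomotopyCategory

end PropositionalIdTypes

/-! ### Contractible types -/

namespace TypeTheory.ClassifyingCategory

variable {S : Signature.{u}} {T : TypeTheory S} {m n : ℕ} {Δ : Ctx S m} {Γ : Ctx S n}
  {hΔ : T.WF Δ} {hΓ : T.WF Γ}

theorem hasElement_subst_of_homMk_eq {s t : Sub S n m} {hs : T.IsMor Δ Γ s} {ht : T.IsMor Δ Γ t}
    (h : homMk hΔ hΓ s hs = homMk hΔ hΓ t ht) {B : Ty S n} (hB : T.Derivable Γ (.isType B))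
    (hBs : T.HasElement Δ (B.subst s)) : T.HasElement Δ (B.subst t) :=
  hBs.conv (MorEq.subst_type hΔ hs (homMk_eq_iff.1 h) hB)

theorem proj_comp_homMk_inst {A : Ty S n} {a : Tm S n} (h : T.WF (Γ.snoc A))
    (ha : T.Derivable Γ (.hasType a A)) :
    proj Γ A h ≫ homMk h.1 h (Sub.inst a) (isMor_inst ha) =
      homMk h h ((Sub.wk S n).cons (a.subst (Sub.wk S n)))
        ((isMor_wk h).cons (weaken ha h.2)) :=
  homMk_congr (Sub.inst_comp a _)

end TypeTheory.ClassifyingCategory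

namespace PropositionalIdTypes

open TypeTheory TypeTheory.ClassifyingCategory

variable {S : Signature.{u}} {T : TypeTheory S} {I : PropositionalIdTypes T}

section HomotopyOfTerms

variable {m n : ℕ} {Δ : Ctx S m} {Γ : Ctx S n} {hΔ : T.WF Δ} {hΓ : T.WF Γ}
  (sums : StrongSums T)
include sums

theorem Homotopic.hasElement_subst {s t : Sub S n m} {hs : T.IsMor Δ Γ s} {ht : T.IsMor Δ Γ t}
    (h : I.Homotopic (homMk hΔ hΓ s hs) (homMk hΔ hΓ t ht)) {B : Ty S n}
    (hB : T.Derivable Γ (.isType B)) (hBs : T.HasElement Δ (B.subst s)) :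
    T.HasElement Δ (B.subst t) := by
  obtain ⟨A, hA, ⟨e⟩⟩ := exists_iso_typeObj sums (ClassifyingCategory.mk Γ hΓ)
  have h := h.pathHomotopic e
  obtain ⟨a, ha, hsa⟩ := exists_eq_termHom (homMk hΔ hΓ s hs ≫ e.hom)
  obtain ⟨b, hb, htb⟩ := exists_eq_termHom (homMk hΔ hΓ t ht ≫ e.hom)
  obtain ⟨w, hw, hwe⟩ := exists_eq_homMk (hΔ := wf_nil_snoc hA) e.inv
  have hBw : T.Derivable (Ctx.nil.snoc A) (.isType (B.subst w)) := subst_mor (wf_nil_snoc hA) hw hB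
  rw [hsa, htb] at h
  have hab : I.PropEq Δ (A.subst fun i => i.elim0) a b := I.pathHomotopic_termHom_iff.1 h
  have hsa' : homMk hΔ hΓ s hs = homMk hΔ hΓ _ (IsMor.comp hΔ hw (isMor_const ha)) := by
    rw [← Category.comp_id (homMk hΔ hΓ s hs), ← e.hom_inv_id, reassoc_of% hsa, hwe]
    rfl
  have htb' : homMk hΔ hΓ _ (IsMor.comp hΔ hw (isMor_const hb)) = homMk hΔ hΓ t ht := by
    rw [← Category.comp_id (homMk hΔ hΓ t ht), ← e.hom_inv_id, reassoc_of% htb, hwe]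
    rfl
  have transport := hab.transport (Γ := .nil) trivial hBw
  rw [Sub.cons_eq_const, Sub.cons_eq_const, Expr.subst_subst, Expr.subst_subst] at transport
  exact hasElement_subst_of_homMk_eq htb' hB
    (transport (hasElement_subst_of_homMk_eq hsa' hB hBs))

theorem PropEq.homotopic {A : Ty S n} {s : Sub S n m} {a b : Tm S m}
    (hab : I.PropEq Δ (A.subst s) a b) (h : T.WF (Γ.snoc A)) (hs : T.IsMor Δ Γ s) :
    I.Homotopic (homMk hΔ h (s.cons a) (hs.cons hab.left))
      (homMk hΔ h (s.cons b) (hs.cons hab.right)) := by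
  obtain ⟨B, hB, ⟨e⟩⟩ := exists_iso_typeObj sums (ClassifyingCategory.mk (Γ.snoc A) h)
  obtain ⟨c, hc, he⟩ := exists_eq_termHom e.hom
  have hc' : T.Derivable (Γ.snoc A) (.hasType c ((B.ofClosed n).subst (Sub.wk S n))) := by
    rwa [Expr.ofClosed_subst]
  have hcab := hab.map hs hc'
  rw [Expr.ofClosed_subst] at hcab
  refine .of_pathHomotopic e ?_
  rw [he, homMk_comp_termHom, homMk_comp_termHom]
  exact I.pathHomotopic_termHom_iff.2 hcab

end HomotopyOfTerms

section Contractible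

variable {m n : ℕ} {Δ : Ctx S m} {Γ : Ctx S n} {A : Ty S n}

variable (I) in
/-- The type `A` is contractible in the context `Γ`: it has an element to which every element is
propositionally equal. -/
def Contractible (Γ : Ctx S n) (A : Ty S n) : Prop :=
  ∃ a, T.Derivable Γ (.hasType a A) ∧
    I.PropEq (Γ.snoc A) (A.subst (Sub.wk S n)) (a.subst (Sub.wk S n)) (.var 0)

theorem Contractible.subst (h : I.Contractible Γ A) (hΔ : T.WF Δ) {s : Sub S n m}
    (hs : T.IsMor Δ Γ s) : I.Contractible Δ (A.subst s) := by
  obtain ⟨a, ha, hcontr⟩ := h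
  have hw : T.WF (Γ.snoc A) := ⟨wf_of_derivable ha, T.presup_hasType ha⟩
  refine ⟨a.subst s, subst_mor hΔ hs ha, ?_⟩
  have hs_lift := hcontr.subst (wf_snoc_subst hΔ hw hs) (hs.lift hΔ hw.2)
  rwa [Expr.subst_wk_subst_lift, Expr.subst_wk_subst_lift] at hs_lift

variable (sums : StrongSums T)
include sums

theorem hasElement_of_homotopyEquivalences_proj {h : T.WF (Γ.snoc A)}
    (hp : I.homotopyEquivalences (proj Γ A h)) : T.HasElement Γ A := by
  obtain ⟨g, -, hgp⟩ := hp
  obtain ⟨s, hs, rfl⟩ := exists_eq_homMk g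
  rw [homMk_comp_proj, id_eq_homMk] at hgp
  have hA := hgp.hasElement_subst sums h.2 ⟨s 0, hs.2⟩
  rwa [Expr.subst_id] at hA

theorem contractible_of_homotopyEquivalences_proj {h : T.WF (Γ.snoc A)}
    (hp : I.homotopyEquivalences (proj Γ A h)) : I.Contractible Γ A := by
  obtain ⟨a, ha⟩ := hasElement_of_homotopyEquivalences_proj sums hp
  have hwa : T.Derivable (Γ.snoc A) (.hasType (a.subst (Sub.wk S n)) (A.subst (Sub.wk S n))) :=
    weaken ha h.2
  have hx := T.var_rule h.2
  have isIso_map_proj := (homotopyEquivalences_iff sums).1 hp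
  have section_comp : homMk h.1 h (Sub.inst a) (isMor_inst ha) ≫ proj Γ A h = 𝟙 _ := rfl
  have comp_section :
      I.Homotopic (proj Γ A h ≫ homMk h.1 h (Sub.inst a) (isMor_inst ha)) (𝟙 _) := by
    rw [← toHomotopyCategory_map_eq_iff sums, ← cancel_mono (I.toHomotopyCategory.map (proj Γ A h)),
      ← Functor.map_comp, ← Functor.map_comp, Category.assoc, section_comp, Category.comp_id,
      Category.id_comp]
  rw [proj_comp_homMk_inst h ha, id_eq_homMk] at comp_section
  have transport := comp_section.hasElement_subst sums (I.Id_form hwa hx)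
  rw [Expr.subst_id] at transport
  refine ⟨a, ha, hwa, hx, transport ?_⟩
  rw [I.Id_subst, Expr.subst_subst, Expr.subst_subst, Sub.wk_comp, Sub.tail_cons, Expr.var_subst,
    Sub.cons_zero]
  exact ⟨_, I.r_intro hwa⟩

theorem homotopyEquivalences_proj_of_contractible (h : T.WF (Γ.snoc A))
    (hA : I.Contractible Γ A) : I.homotopyEquivalences (proj Γ A h) := by
  obtain ⟨a, ha, hcontr⟩ := hA
  have id_eq : 𝟙 (ClassifyingCategory.mk (Γ.snoc A) h) =
      homMk h h ((Sub.wk S n).cons (.var 0)) ((isMor_wk h).cons hcontr.right) :=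
    homMk_congr (Sub.cons_tail (Sub.id S (n + 1))).symm
  refine ⟨homMk h.1 h (Sub.inst a) (isMor_inst ha), ?_, .refl sums _⟩
  rw [proj_comp_homMk_inst h ha, id_eq]
  exact hcontr.homotopic sums h (isMor_wk h)

theorem homotopyEquivalences_proj_iff {h : T.WF (Γ.snoc A)} :
    I.homotopyEquivalences (proj Γ A h) ↔ I.Contractible Γ A :=
  ⟨contractible_of_homotopyEquivalences_proj sums,
    homotopyEquivalences_proj_of_contractible sums h⟩

end Contractible

section AcyclicFibrations

variable (sums : StrongSums T)
include sums

theorem exists_section_of_acyclic {X Y : T.ClassifyingCategory} (p : X ⟶ Y)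
    (hp : T.fibrations p) (hp' : I.homotopyEquivalences p) : ∃ s : Y ⟶ X, s ≫ p = 𝟙 Y := by
  have := respectsIso_homotopyEquivalences (I := I) sums
  obtain ⟨n, Γ, hΓ, rfl⟩ := exists_eq_mk Y
  obtain ⟨A, h, i, rfl⟩ := (fibrations_iff sums).1 hp
  obtain ⟨a, ha⟩ := hasElement_of_homotopyEquivalences_proj sums
    ((I.homotopyEquivalences.cancel_left_of_respectsIso i.hom _).1 hp')
  refine ⟨homMk hΓ h (Sub.inst a) (isMor_inst ha) ≫ i.inv, ?_⟩
  rw [Category.assoc, Iso.inv_hom_id_assoc]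
  rfl

theorem isStableUnderBaseChange_acyclicFibrations :
    (T.fibrations ⊓ I.homotopyEquivalences).IsStableUnderBaseChange := by
  have := respectsIso_homotopyEquivalences (I := I) sums
  refine isStableUnderBaseChange_of_le_fibrations sums _ inf_le_left ?_
  rintro m n Δ Γ A hΔ h t ht ⟨-, hp⟩
  refine ⟨fibrations_proj _, ?_⟩
  rw [homotopyEquivalences_proj_iff sums] at hp ⊢
  exact hp.subst hΔ ht

end AcyclicFibrations

end PropositionalIdTypes

/-! ### Path objects -/

/-- Path objects may be transferred along isomorphisms. -/
noncomputable def PathObject.ofIso {C : Type u} [Category.{v} C] {weq fib : MorphismProperty C}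
    [weq.RespectsIso] {B B' : C} (P : PathObject weq fib B) (e : B ≅ B') :
    PathObject weq fib B' :=
  have fac {p : P.prod.pt ⟶ B} (h : P.r ≫ P.st ≫ p = 𝟙 B) :
      (e.inv ≫ P.r) ≫ P.st ≫ p ≫ e.hom = 𝟙 B' := by
    simp only [Category.assoc, reassoc_of% h, Iso.inv_hom_id]
  { prod := BinaryFan.mk (P.prod.fst ≫ e.hom) (P.prod.snd ≫ e.hom)
    isLimit :=
      BinaryFan.isLimitCompRightIso _ e.hom (BinaryFan.isLimitCompLeftIso _ e.hom P.isLimit)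
    obj := P.obj
    r := e.inv ≫ P.r
    st := P.st
    weq_r := (weq.cancel_left_of_respectsIso e.inv P.r).2 P.weq_r
    fib_st := P.fib_st
    fac_fst := fac P.fac_fst
    fac_snd := fac P.fac_snd }

namespace PropositionalIdTypes

open TypeTheory TypeTheory.ClassifyingCategory

variable {S : Signature.{u}} {T : TypeTheory S} (I : PropositionalIdTypes T)

section PathObjects

variable {A : Ty S 0} (hA : T.Derivable .nil (.isType A))

/-- The morphism `x ↦ (x, x, r(x))` from `[x ∈ A]` to its path object. -/
def reflHom : typeObj hA ⟶ I.pathObj hA :=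
  homMk (wf_nil_snoc hA) (I.wf_idCtx hA) (idDiag I.r A) (I.isMor_idDiag hA)

theorem isPullback_typeObj :
    IsPullback (proj (Ctx.nil.snoc A) (A.subst (Sub.wk S 0)) (I.wf_idCtx hA).1)
      (homMk (I.wf_idCtx hA).1 (wf_nil_snoc hA) (Sub.wk S 0).lift
        ((isMor_wk (wf_nil_snoc hA)).lift (wf_nil_snoc hA) hA))
      (proj .nil A (wf_nil_snoc hA)) (proj .nil A (wf_nil_snoc hA)) :=
  (isPullback_proj (wf_nil_snoc hA) (isMor_wk (wf_nil_snoc hA))).flip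

theorem reflHom_comp_src : I.reflHom hA ≫ I.src hA = 𝟙 (typeObj hA) :=
  homMk_congr (s := Sub.comp (fun _ => .var 2) (idDiag I.r A)) (t := Sub.id S 1)
    (funext (Fin.forall_fin_one.2 rfl))

variable {I hA}

theorem PathHomotopic.of_reflHom_comp {B : Ty S 0} {hB : T.Derivable .nil (.isType B)}
    {f g : I.pathObj hA ⟶ typeObj hB}
    (h : I.PathHomotopic hB (I.reflHom hA ≫ f) (I.reflHom hA ≫ g)) : I.PathHomotopic hB f g := by
  obtain ⟨a, ha, rfl⟩ := exists_eq_termHom (hΔ := I.wf_idCtx hA) f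
  obtain ⟨b, hb, rfl⟩ := exists_eq_termHom (hΔ := I.wf_idCtx hA) g
  have hdiag := I.isMor_idDiag hA
  have diag : I.PropEq (Ctx.nil.snoc A) (B.ofClosed 1) (a.subst (idDiag I.r A))
      (b.subst (idDiag I.r A)) :=
    (I.pathHomotopic_termHom_iff (ha := hasType_subst_ofClosed (wf_nil_snoc hA) ha hdiag)
      (hb := hasType_subst_ofClosed (wf_nil_snoc hA) hb hdiag)).1 h
  refine I.pathHomotopic_termHom_iff.2 ⟨ha, hb, I.hasElement_idCtx (I.Id_form ha hb) ?_⟩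
  rw [I.Id_subst, Expr.ofClosed_subst]
  exact diag.hasElement

variable (sums : StrongSums T)
include sums

theorem Homotopic.of_reflHom_comp {Y : T.ClassifyingCategory} {f g : I.pathObj hA ⟶ Y}
    (h : I.Homotopic (I.reflHom hA ≫ f) (I.reflHom hA ≫ g)) : I.Homotopic f g := by
  obtain ⟨B, hB, ⟨e⟩⟩ := exists_iso_typeObj sums Y
  refine .of_pathHomotopic e (.of_reflHom_comp ?_)
  simpa only [Category.assoc] using h.pathHomotopic e

theorem homotopyEquivalences_reflHom : I.homotopyEquivalences (I.reflHom hA) := by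
  refine ⟨I.src hA, ?_, .of_reflHom_comp sums ?_⟩
  · rw [reflHom_comp_src]
    exact .refl sums _
  · rw [← Category.assoc, reflHom_comp_src, Category.id_comp, Category.comp_id]
    exact .refl sums _

variable (I hA) in
/-- The path object `[x ∈ A, y ∈ A, u ∈ Id_A(x, y)]` of a closed type `A`, whose map from `[x ∈ A]`
is reflexivity. -/
noncomputable def pathObjectTypeObj :
    PathObject I.homotopyEquivalences T.fibrations (typeObj hA) where
  prod := BinaryFan.mk _ _
  isLimit := isProductOfIsTerminalIsPullback _ _ _ _ isTerminalNil
    (I.isPullback_typeObj hA).isLimit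
  obj := I.pathObj hA
  r := I.reflHom hA
  st := proj _ _ (I.wf_idCtx hA)
  weq_r := homotopyEquivalences_reflHom sums
  fib_st := fibrations_proj _
  fac_fst := homMk_congr I.idFst_comp_idDiag
  fac_snd := homMk_congr (s := ((Sub.wk S 0).lift.comp (Sub.wk S 2)).comp (idDiag I.r A))
    (t := Sub.id S 1) (funext (Fin.forall_fin_one.2 rfl))

theorem nonempty_pathObject (B : T.ClassifyingCategory) :
    Nonempty (PathObject I.homotopyEquivalences T.fibrations B) := by
  have := respectsIso_homotopyEquivalences (I := I) sums
  obtain ⟨A, hA, ⟨e⟩⟩ := exists_iso_typeObj sums B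
  exact ⟨(I.pathObjectTypeObj hA sums).ofIso e.symm⟩

end PathObjects

/-- The classifying category as a path category. -/
def pathCategory (sums : StrongSums T) : PathCategory T.ClassifyingCategory where
  fib := T.fibrations
  weq := I.homotopyEquivalences
  fib_of_isIso f _ :=
    have := isMultiplicative_fibrations sums
    T.fibrations.of_isIso f
  fib_comp := (isMultiplicative_fibrations sums).comp_mem
  hasPullback := hasPullback_of_fibrations sums
  fib_pullback := (isStableUnderBaseChange_fibrations sums).of_isPullback
  hasTerminal := isTerminalNil.hasTerminal
  fib_terminal := fibrations_of_isTerminal sums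
  weq_of_isIso f _ :=
    have := isMultiplicative_homotopyEquivalences (I := I) sums
    have := respectsIso_homotopyEquivalences (I := I) sums
    I.homotopyEquivalences.of_isIso f
  two_out_of_six := homotopyEquivalences_two_out_of_six sums
  pathObject := nonempty_pathObject sums
  acyclic_section := exists_section_of_acyclic sums
  acyclic_pullback sq hp hp' :=
    (isStableUnderBaseChange_acyclicFibrations sums).of_isPullback sq ⟨hp, hp'⟩

end PropositionalIdTypes

end DTT

theorem mainTheorem3 {S : DTT.Signature.{u}} (T : DTT.TypeTheory S) (_sums : DTT.StrongSums T)
    (I : DTT.PropositionalIdTypes T) :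
    ∃ P : DTT.PathCategory T.ClassifyingCategory,
      P.fib = T.fibrations ∧ P.weq = I.homotopyEquivalences := by
  exact ⟨I.pathCategory _sums, rfl, rfl⟩
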